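/- Let $m\ge 2$ and $h\ge 0$ be integers. Let $T_{m,h}$ be the complete $m$-ary tree of height $h$, with root $r$, and let $T^+_{m,h}$ be the extended tree obtained from it by adding one new vertex $r'$ (the stem) and the edge $\{r,r'\}$. When $h\ge 1$, denote the children of $r$ in $T_{m,h}$ by $r_1,\dots,r_m$. For a finite graph $G=(V,E)$ and $S\subseteq V$ let $\mathcal P^0(S)=N_G[S]$ be the closed neighbourhood of $S$, and for $k\ge 1$ let $\mathcal P^{k}(S)=\mathcal P^{k-1}(S)\cup\bigcup_{v\in\mathcal P^{k-1}(S)}\{x\in V: N_G(v)\setminus\mathcal P^{k-1}(S)=\{x\}\}$. Let $\mathrm{Obs}(G,S)$ be the set at which this increasing sequence stabilizes; $S$ is a power dominating set for $G$ if $\mathrm{Obs}(G,S)=V$. A set $S\subseteq V(T^+_{m,h})\setminus\{r'\}$ is of Type I if it is a power dominating set for $T^+_{m,h}$, and of Type II if it is not, but $S\cup\{r'\}$ is. For $k\in\mathbb Z$ let $E^k_{m,h}$ and $H^k_{m,h}$ be the numbers of Type I and of Type II sets of size $k$ for $T^+_{m,h}$, respectively. For $0\le\ell\le m$ put $$\left\langle\mathcal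 H^{\ell}\oplus\mathcal E^{m-\ell}\right\rangle^{k}_{m,h}=\sum_{\substack{i_1\le\cdots\le i_\ell\\ i_{\ell+1}\le\cdots\le i_m\\ i_1+\cdots+i_m=k}}\binom m\ell\binom{\ell}{s_0,\dots,s_k}\binom{m-\ell}{t_0,\dots,t_k}\prod_{1\le j\le \ell}H^{i_j}_{m,h}\prod_{\ell<j\le m}E^{i_j}_{m,h},$$ where the sum is over tuples of nonnegative integers (so it is $0$ if $k<0$), $s_\alpha=|\{j\in[1,\ell]: i_j=\alpha\}|$ and $t_\beta=|\{j\in[\ell+1,m]:i_j=\beta\}|$. **Lemma.** Let $m\ge 2$, $h\ge 1$ and $G=T^+_{m,h}$. If $S$ is a Type II set for $G$, then $$N_G[r]\setminus\mathrm{Obs}(G,S)=\begin{cases}\{r',r_i\}\text{ for some } i\in\{1,\dots,m\}, & h \text{ odd},\\ \{r',r\}, & h\text{ even}.\end{cases}$$ Furthermore, for every integer $k$, $$H^k_{m,h}=\begin{cases}\left\langle\mathcal H^{1}\oplus\mathcal E^{m-1}\right\rangle^{k}_{m,h-1}, & h\text{ odd},\\ \left\langle\mathcal H^{m}\oplus\mathcal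 E^{0}\right\rangle^{k}_{m,h-1}, & h\text{ even},\end{cases}$$ and $$E^k_{m,h}=\begin{cases}\left\langle\mathcal H^{0}\oplus\mathcal E^{m}\right\rangle^{k}_{m,h-1}+\sum_{\ell=0}^{m}\left\langle\mathcal H^{\ell}\oplus\mathcal E^{m-\ell}\right\rangle^{k-1}_{m,h-1}, & h\text{ odd},\\ \sum_{\ell=0}^{m-1}\left\langle\mathcal H^{\ell}\oplus\mathcal E^{m-\ell}\right\rangle^{k}_{m,h-1}+\sum_{\ell=0}^{m}\left\langle\mathcal H^{\ell}\oplus\mathcal E^{m-\ell}\right\rangle^{k-1}_{m,h-1}, & h\text{ even}.\end{cases}$$ -/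

import Mathlib

/-! Power domination of graphs, extended complete `m`-ary trees, Type I / Type II sets,
their counting functions and the bracket sums. -/

namespace PowerDom

section Graphs

variable {V : Type*}

/-- The closed neighbourhood `N[S]` of a set of vertices. -/
def closedNbhd (G : SimpleGraph V) (S : Set V) : Set V :=
  {x | x ∈ S ∨ ∃ v ∈ S, G.Adj v x}

/-- `N*(A)`: the vertices `x` such that some `v ∈ A` has `x` as its only neighbour outside `A`. -/
def forced (G : SimpleGraph V) (A : Set V) : Set V :=
  {x | ∃ v ∈ A, G.neighborSet v \ A = {x}}

/-- The sets `P^k(S)` of the power domination process started from `S`. -/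
def propagation (G : SimpleGraph V) (S : Set V) : ℕ → Set V
  | 0 => closedNbhd G S
  | k + 1 => propagation G S k ∪ forced G (propagation G S k)

/-- `Obs(G, S) = P^∞(S)`. The sets `P^k(S)` increase with `k`, so on a finite graph this union is
the value at which they stabilize. -/
def obs (G : SimpleGraph V) (S : Set V) : Set V :=
  ⋃ k, propagation G S k

/-- `S` is a power dominating set for `G`. -/
def IsPowerDominating (G : SimpleGraph V) (S : Set V) : Prop :=
  obs G S = Set.univ

end Graphs

/-- Vertices of the complete `m`-ary tree `T_{m,h}`: words of length at most `h` over `Fin m`.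
The word lists the choices of a child along the path from the root. -/
abbrev TreeVertex (m h : ℕ) : Type := {w : List (Fin m) // w.length ≤ h}

instance (m h : ℕ) : Finite (TreeVertex m h) :=
  (List.finite_length_le (Fin m) h).to_subtype

/-- The complete `m`-ary tree `T_{m,h}`: the children of `u` are the words `u ++ [i]`. -/
def completeTree (m h : ℕ) : SimpleGraph (TreeVertex m h) :=
  SimpleGraph.fromRel fun u v => ∃ i : Fin m, v.1 = u.1 ++ [i]

/-- The root of `T_{m,h}`. -/
def treeRoot (m h : ℕ) : TreeVertex m h := ⟨[], Nat.zero_le h⟩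

/-- The vertex set of the extended tree `T⁺_{m,h}`; `none` is the added vertex. -/
abbrev ExtVertex (m h : ℕ) : Type := Option (TreeVertex m h)

/-- The stem `r'` of `T⁺_{m,h}`. -/
def stem (m h : ℕ) : ExtVertex m h := none

/-- The root `r` of `T⁺_{m,h}`. -/
def root (m h : ℕ) : ExtVertex m h := some (treeRoot m h)

/-- The `i`-th child `r_i` of the root of `T⁺_{m,h}`, where `h ≥ 1`. -/
def rootChild (m h : ℕ) (hh : 1 ≤ h) (i : Fin m) : ExtVertex m h := some ⟨[i], hh⟩

/-- The extended `m`-ary tree `T⁺_{m,h}`: the tree `T_{m,h}` together with the stem `r'` and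
the edge `{r, r'}`. -/
def extTree (m h : ℕ) : SimpleGraph (ExtVertex m h) :=
  (completeTree m h).map some ⊔ SimpleGraph.edge (root m h) (stem m h)

/-- `S ⊆ V(T⁺_{m,h}) ∖ {r'}` is of Type I. -/
def IsTypeI (m h : ℕ) (S : Set (ExtVertex m h)) : Prop :=
  stem m h ∉ S ∧ IsPowerDominating (extTree m h) S

/-- `S ⊆ V(T⁺_{m,h}) ∖ {r'}` is of Type II. -/
def IsTypeII (m h : ℕ) (S : Set (ExtVertex m h)) : Prop :=
  stem m h ∉ S ∧ ¬ IsPowerDominating (extTree m h) S ∧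
    IsPowerDominating (extTree m h) (S ∪ {stem m h})

/-- `E_{m,h}^k`: the number of Type I sets of size `k` for `T⁺_{m,h}`. -/
noncomputable def numE (m h : ℕ) (k : ℤ) : ℕ :=
  {S : Set (ExtVertex m h) | IsTypeI m h S ∧ (S.ncard : ℤ) = k}.ncard

/-- `H_{m,h}^k`: the number of Type II sets of size `k` for `T⁺_{m,h}`. -/
noncomputable def numH (m h : ℕ) (k : ℤ) : ℕ :=
  {S : Set (ExtVertex m h) | IsTypeII m h S ∧ (S.ncard : ℤ) = k}.ncard

/-- The tuples `(i_1, …, i_m)` of nonnegative integers with sum `k` whose first `l` entries are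
in nondecreasing order and whose last `m - l` entries are in nondecreasing order
(`i_j` is the value at `j - 1 : Fin m`). -/
def sortedTuples (m l : ℕ) (k : ℤ) : Finset (Fin m → ℕ) :=
  (Fintype.piFinset fun _ : Fin m => Finset.range (k.toNat + 1)).filter fun i =>
    (∀ a b : Fin m, a ≤ b → b.val < l → i a ≤ i b) ∧
    (∀ a b : Fin m, l ≤ a.val → a ≤ b → i a ≤ i b) ∧
    ∑ j, (i j : ℤ) = k

/-- The bracket sum `⟨H^l ⊕ E^{m-l}⟩_{m,h}^k`. -/
noncomputable def bracket (m h l : ℕ) (k : ℤ) : ℕ :=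
  ∑ i ∈ sortedTuples m l k,
    m.choose l *
    Nat.multinomial (Finset.range (k.toNat + 1))
      (fun α => (Finset.univ.filter fun j : Fin m => j.val < l ∧ i j = α).card) *
    Nat.multinomial (Finset.range (k.toNat + 1))
      (fun β => (Finset.univ.filter fun j : Fin m => l ≤ j.val ∧ i j = β).card) *
    (∏ j ∈ Finset.univ.filter (fun j : Fin m => j.val < l), numH m h (i j)) *
    (∏ j ∈ Finset.univ.filter (fun j : Fin m => l ≤ j.val), numE m h (i j))

end PowerDom

open PowerDom

/-!
Write `r` for the root, `r'` for the stem and `r_i` for the children of `r`. The proof peels off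
the root. The part of `T⁺_{m,h+1}` hanging off `r` through `r_i` is a copy of `T⁺_{m,h}` with stem
`r`, and a set `S` avoiding `r'` amounts to the information whether `r ∈ S` together with its parts
`restr S i ⊆ T⁺_{m,h}`. The observed set is the least set that contains the closed neighbourhood of
`S` and in which no vertex forces a new one (`obs_subset`, `stableAt_obs`). Hence observations made
in a copy remain valid in the whole tree (`obs_restr_subset`, `obs_restr_union_subset`), and stable
sets glued from the copies bound the observed set from above (`obs_subset_glue`).

If `S` is of Type I or II, each part is of Type I or II. If `r ∈ S`, this is also sufficient, and
`S` is of Type I (`isTypeI_iff_of_root_mem`). If `r ∉ S`, the outcome depends on whether a Type II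
set of `T⁺_{m,h}` observes the root of that tree:

* If it does not, a part of Type II needs help from `r`, which can force only one neighbour. So `S`
  is of Type I if all parts are, of Type II if exactly one part is of Type II (`r` is then observed
  by the remaining parts, while `r'` and one child are not), and neither otherwise.
* If it does, all `r_i` are observed anyway, and a part of Type II only waits for `r` to be
  observed. One part of Type I achieves this, and then `S` is of Type I. If all parts are of
  Type II, so is `S`, and exactly `r'` and `r` are unobserved in the closed neighbourhood of `r`.

In the first case Type II sets of `T⁺_{m,h+1}` observe the root, in the second they do not. Since
they do not for height `0`, the cases alternate with the parity (`IsTypeII.root_mem_obs_iff`).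

For the counts, it remains to identify the bracket sum with the number of families of `m` sets of
given total size, all of Type I or II and exactly `l` of them of Type II (`ncard_families`). Sorting
groups the tuples of sizes, and a sorted tuple arises from as many tuples as a multinomial
coefficient says (`sum_symmetric_eq_sum_monotone`); the binomial coefficient counts the positions of
the members of Type II (`bracket_eq_sum_mixedSum`).
-/

namespace PowerDom

/-! ### Sums over tuples and sums over sorted tuples -/

lemma sum_card_fiber {n : ℕ} {s : Finset ℕ} {a : Fin n → ℕ} (ha : ∀ j, a j ∈ s) :
    ∑ α ∈ s, (Finset.univ.filter fun j => a j = α).card = n := by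
  rw [← Finset.card_eq_sum_card_fiberwise (fun j _ => ha j)]
  simp

lemma card_perm_comp_eq {n : ℕ} {s : Finset ℕ} {a : Fin n → ℕ} (ha : ∀ j, a j ∈ s)
    (τ : Equiv.Perm (Fin n)) :
    (Finset.univ.filter fun σ : Equiv.Perm (Fin n) => a ∘ σ = a ∘ τ).card =
      ∏ α ∈ s, (Finset.univ.filter fun j => a j = α).card.factorial := by
  have h1 : (Finset.univ.filter fun σ : Equiv.Perm (Fin n) => a ∘ σ = a ∘ τ).card =
      Fintype.card {g : Equiv.Perm (Fin n) // a ∘ g = a} := by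
    rw [Fintype.card_subtype]
    refine Finset.card_bij (fun σ _ => σ * τ⁻¹) ?_ ?_ ?_
    · intro σ hσ
      simp only [Finset.mem_filter, Finset.mem_univ, true_and] at hσ ⊢
      funext j
      simpa using congrFun hσ (τ⁻¹ j)
    · intro σ _ σ' _ h
      simpa using h
    · intro g hg
      simp only [Finset.mem_filter, Finset.mem_univ, true_and] at hg
      refine ⟨g * τ, ?_, by simp⟩
      simp only [Finset.mem_filter, Finset.mem_univ, true_and]
      funext j
      simpa using congrFun hg (τ j)
  rw [h1, DomMulAct.stabilizer_card']
  simp only [Fintype.card_subtype]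
  refine Finset.prod_subset ?_ ?_
  · intro x hx
    obtain ⟨j, -, rfl⟩ := Finset.mem_image.1 hx
    exact ha j
  · intro α _ hα
    have : (Finset.univ.filter fun j => a j = α) = ∅ := by
      ext j
      simp only [Finset.mem_filter, Finset.mem_univ, true_and, Finset.notMem_empty, iff_false]
      rintro rfl
      exact hα (Finset.mem_image_of_mem _ (Finset.mem_univ _))
    simp [this]

/-- The tuples which become the nondecreasing tuple `a` when sorted are counted by a multinomial
coefficient: each of the `n!` permutations of `a` is one of them, and each arises from as many
permutations as there are in the stabilizer of `a`. -/
lemma card_sort_eq {n : ℕ} {s : Finset ℕ} {a : Fin n → ℕ} (ha : ∀ j, a j ∈ s)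
    (hmono : Monotone a) :
    ((Fintype.piFinset fun _ : Fin n => s).filter fun b => b ∘ Tuple.sort b = a).card =
      Nat.multinomial s (fun α => (Finset.univ.filter fun j => a j = α).card) := by
  have hmaps : ∀ σ ∈ (Finset.univ : Finset (Equiv.Perm (Fin n))),
      a ∘ σ ∈ (Fintype.piFinset fun _ : Fin n => s).filter fun b => b ∘ Tuple.sort b = a := by
    intro σ _
    simp only [Finset.mem_filter, Fintype.mem_piFinset, Function.comp_apply]
    refine ⟨fun j => ha _, ?_⟩
    rw [Tuple.comp_perm_comp_sort_eq_comp_sort, Tuple.sort_eq_refl_iff_monotone.2 hmono]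
    rfl
  have h1 := Finset.card_eq_sum_card_fiberwise hmaps
  have h2 : ∀ b ∈ (Fintype.piFinset fun _ : Fin n => s).filter fun b => b ∘ Tuple.sort b = a,
      (Finset.univ.filter fun σ : Equiv.Perm (Fin n) => a ∘ σ = b).card =
      ∏ α ∈ s, (Finset.univ.filter fun j => a j = α).card.factorial := by
    intro b hb
    have hb' : b = a ∘ ((Tuple.sort b)⁻¹ : Equiv.Perm (Fin n)) := by
      conv_rhs => rw [← (Finset.mem_filter.1 hb).2]
      funext j
      simp
    rw [hb', card_perm_comp_eq ha]
  rw [Finset.sum_congr rfl h2, Finset.sum_const, smul_eq_mul, Finset.card_univ,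
    Fintype.card_perm, Fintype.card_fin] at h1
  have h3 := Nat.multinomial_spec s fun α => (Finset.univ.filter fun j => a j = α).card
  rw [sum_card_fiber ha, h1, mul_comm] at h3
  exact (Nat.eq_of_mul_eq_mul_right
    (Finset.prod_pos fun i _ => Nat.factorial_pos _) h3).symm

lemma sum_symmetric_eq_sum_monotone {n : ℕ} (s : Finset ℕ) (Φ : (Fin n → ℕ) → ℕ)
    (hΦ : ∀ a (σ : Equiv.Perm (Fin n)), Φ (a ∘ σ) = Φ a) :
    ∑ a ∈ Fintype.piFinset (fun _ : Fin n => s), Φ a =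
      ∑ a ∈ (Fintype.piFinset fun _ : Fin n => s).filter (fun a => Monotone a),
        Nat.multinomial s (fun α => (Finset.univ.filter fun j => a j = α).card) * Φ a := by
  have hmaps : ∀ b ∈ Fintype.piFinset (fun _ : Fin n => s), b ∘ Tuple.sort b ∈
      (Fintype.piFinset fun _ : Fin n => s).filter (fun a => Monotone a) := by
    intro b hb
    simp only [Finset.mem_filter, Fintype.mem_piFinset, Function.comp_apply] at hb ⊢
    exact ⟨fun j => hb _, Tuple.monotone_sort b⟩
  rw [← Finset.sum_fiberwise_of_maps_to hmaps]
  refine Finset.sum_congr rfl fun a ha => ?_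
  simp only [Finset.mem_filter, Fintype.mem_piFinset] at ha
  rw [← card_sort_eq ha.1 ha.2, ← smul_eq_mul, ← Finset.sum_const]
  refine Finset.sum_congr rfl fun b hb => ?_
  rw [← (Finset.mem_filter.1 hb).2, hΦ]

/-- The sum, over all tuples `i` of nonnegative integers with sum `K`, of the product of `x (i j)`
over the positions `j ∈ L` and of `y (i j)` over the other positions. -/
def mixedSum (m : ℕ) (x y : ℕ → ℕ) (L : Finset (Fin m)) (K : ℕ) : ℕ :=
  ∑ i ∈ Fintype.piFinset fun _ : Fin m => Finset.range (K + 1),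
    if ∑ j, i j = K then ∏ j, (if j ∈ L then x (i j) else y (i j)) else 0

lemma mixedSum_map (m : ℕ) (x y : ℕ → ℕ) (L : Finset (Fin m)) (K : ℕ)
    (σ : Equiv.Perm (Fin m)) :
    mixedSum m x y (L.map σ.toEmbedding) K = mixedSum m x y L K := by
  unfold mixedSum
  refine Finset.sum_bij' (fun i _ => i ∘ σ) (fun i _ => i ∘ σ.symm) ?_ ?_ ?_ ?_ ?_
  · intro i hi
    simp only [Fintype.mem_piFinset, Function.comp_apply] at hi ⊢
    exact fun j => hi _
  · intro i hi
    simp only [Fintype.mem_piFinset, Function.comp_apply] at hi ⊢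
    exact fun j => hi _
  · intro i _
    funext j
    simp
  · intro i _
    funext j
    simp
  · intro i _
    have h1 : ∑ j, (i ∘ σ) j = ∑ j, i j := Equiv.sum_comp σ i
    rw [h1, ← Equiv.prod_comp σ]
    simp

lemma mixedSum_eq_of_card_eq (m : ℕ) (x y : ℕ → ℕ) {L L' : Finset (Fin m)} (K : ℕ)
    (h : L.card = L'.card) : mixedSum m x y L K = mixedSum m x y L' K := by
  obtain ⟨σ, hσ⟩ : ∃ σ : Equiv.Perm (Fin m), L.map σ.toEmbedding = L' := by
    let e : L ≃ L' := Finset.equivOfCardEq h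
    refine ⟨e.extendSubtype, ?_⟩
    refine Finset.eq_of_subset_of_card_le ?_ (by simp [h])
    intro j hj
    obtain ⟨i, hi, rfl⟩ := Finset.mem_map.1 hj
    exact e.extendSubtype_mem i hi
  rw [← hσ, mixedSum_map]

lemma mixedSum_castAdd (l n : ℕ) (x y : ℕ → ℕ) (K : ℕ) :
    mixedSum (l + n) x y (Finset.univ.filter fun j => j.val < l) K =
      ∑ a ∈ Fintype.piFinset fun _ : Fin l => Finset.range (K + 1),
        ∑ b ∈ Fintype.piFinset fun _ : Fin n => Finset.range (K + 1),
          if ∑ j, a j + ∑ j, b j = K then (∏ j, x (a j)) * ∏ j, y (b j) else 0 := by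
  rw [← Finset.sum_product', mixedSum]
  symm
  refine Finset.sum_bij' (fun p _ => Fin.append p.1 p.2)
    (fun i _ => (fun j => i (Fin.castAdd n j), fun j => i (Fin.natAdd l j))) ?_ ?_ ?_ ?_ ?_
  · rintro ⟨a, b⟩ hp
    simp only [Finset.mem_product, Fintype.mem_piFinset] at hp ⊢
    intro j
    refine Fin.addCases (fun j => ?_) (fun j => ?_) j
    · simpa using hp.1 j
    · simpa using hp.2 j
  · intro i hi
    simp only [Finset.mem_product, Fintype.mem_piFinset] at hi ⊢
    exact ⟨fun j => hi _, fun j => hi _⟩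
  · rintro ⟨a, b⟩ _
    simp
  · intro i _
    exact Fin.append_castAdd_natAdd
  · rintro ⟨a, b⟩ _
    simp [Fin.sum_univ_add, Fin.prod_univ_add]

lemma bracket_eq_sum_monotone (l n h K : ℕ) :
    bracket (l + n) h l K = (l + n).choose l *
      ∑ b ∈ (Fintype.piFinset fun _ : Fin n => Finset.range (K + 1)).filter
          (fun b => Monotone b),
        ∑ a ∈ (Fintype.piFinset fun _ : Fin l => Finset.range (K + 1)).filter
            (fun a => Monotone a),
          Nat.multinomial (Finset.range (K + 1))
              (fun α => (Finset.univ.filter fun j => b j = α).card) *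
            (Nat.multinomial (Finset.range (K + 1))
              (fun α => (Finset.univ.filter fun j => a j = α).card) *
              if ∑ j, a j + ∑ j, b j = K then
                (∏ j, numH (l + n) h (a j)) * ∏ j, numE (l + n) h (b j) else 0) := by
  rw [Finset.sum_comm, ← Finset.sum_product', Finset.mul_sum, bracket]
  have key : ∀ i : Fin (l + n) → ℕ,
      (∀ a b : Fin (l + n), a ≤ b → b.val < l → i a ≤ i b) ↔
        Monotone fun j => i (Fin.castAdd n j) := by
    intro i
    refine ⟨fun H a b hab => H (Fin.castAdd n a) (Fin.castAdd n b) hab b.2, ?_⟩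
    intro H a b hab hb
    exact H (a := ⟨a.1, lt_of_le_of_lt hab hb⟩) (b := ⟨b.1, hb⟩) hab
  have key2 : ∀ i : Fin (l + n) → ℕ,
      (∀ a b : Fin (l + n), l ≤ a.val → a ≤ b → i a ≤ i b) ↔
        Monotone fun j => i (Fin.natAdd l j) := by
    intro i
    refine ⟨fun H a b hab => H (Fin.natAdd l a) (Fin.natAdd l b) (Nat.le_add_right _ _)
      (Nat.add_le_add_left hab l), ?_⟩
    intro H a b ha hab
    obtain ⟨a', rfl⟩ : ∃ a', a = Fin.natAdd l a' :=
      ⟨⟨a.1 - l, by omega⟩, by ext; simp; omega⟩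
    obtain ⟨b', rfl⟩ : ∃ b', b = Fin.natAdd l b' :=
      ⟨⟨b.1 - l, by have := Fin.le_def.1 hab; omega⟩,
        by have := Fin.le_def.1 hab; ext; simp; omega⟩
    exact H (Nat.le_of_add_le_add_left hab : a'.1 ≤ b'.1)
  have cardl : ∀ (i : Fin (l + n) → ℕ) (α : ℕ),
      (Finset.univ.filter fun j : Fin (l + n) => j.val < l ∧ i j = α).card =
        (Finset.univ.filter fun j : Fin l => i (Fin.castAdd n j) = α).card := by
    intro i α
    simp only [Finset.card_filter, Fin.sum_univ_add]
    simp
  have cardr : ∀ (i : Fin (l + n) → ℕ) (α : ℕ),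
      (Finset.univ.filter fun j : Fin (l + n) => l ≤ j.val ∧ i j = α).card =
        (Finset.univ.filter fun j : Fin n => i (Fin.natAdd l j) = α).card := by
    intro i α
    simp only [Finset.card_filter, Fin.sum_univ_add]
    simp
  have prodl : ∀ f : Fin (l + n) → ℕ,
      (∏ j ∈ Finset.univ.filter (fun j : Fin (l + n) => j.val < l), f j) =
        ∏ j, f (Fin.castAdd n j) := by
    intro f
    rw [Finset.prod_filter, Fin.prod_univ_add]
    simp
  have prodr : ∀ f : Fin (l + n) → ℕ,
      (∏ j ∈ Finset.univ.filter (fun j : Fin (l + n) => l ≤ j.val), f j) =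
        ∏ j, f (Fin.natAdd l j) := by
    intro f
    rw [Finset.prod_filter, Fin.prod_univ_add, Finset.prod_eq_one, one_mul]
    · simp
    · intro j _
      exact if_neg (Nat.not_le.2 j.2)
  have split : ∀ i : Fin (l + n) → ℕ, (∑ j, (i j : ℤ) = (K : ℤ)) ↔
      ∑ j, i (Fin.castAdd n j) + ∑ j, i (Fin.natAdd l j) = K := by
    intro i
    rw [Fin.sum_univ_add]
    norm_cast
  simp only [sortedTuples, key, key2, split, cardl, cardr, prodl, prodr, Int.toNat_natCast]
  have : ∀ i : Fin (l + n) → ℕ, i ∈ Fintype.piFinset (fun _ : Fin (l + n) =>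
      Finset.range (K + 1)) ↔ (∀ j, i (Fin.castAdd n j) ∈ Finset.range (K + 1)) ∧
        ∀ j, i (Fin.natAdd l j) ∈ Finset.range (K + 1) := by
    intro i
    rw [Fintype.mem_piFinset]
    exact ⟨fun H => ⟨fun j => H _, fun j => H _⟩,
      fun H j => Fin.addCases (motive := fun j => i j ∈ Finset.range (K + 1)) H.1 H.2 j⟩
  symm
  rw [← Finset.sum_subset (s₁ := (((Fintype.piFinset fun _ : Fin l =>
      Finset.range (K + 1)).filter (fun a => Monotone a)) ×ˢ
      ((Fintype.piFinset fun _ : Fin n =>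
      Finset.range (K + 1)).filter (fun a => Monotone a))).filter
        (fun p => ∑ j, p.1 j + ∑ j, p.2 j = K)) (Finset.filter_subset _ _)]
  · refine Finset.sum_bij' (fun p _ => Fin.append p.1 p.2)
      (fun i _ => (fun j => i (Fin.castAdd n j), fun j => i (Fin.natAdd l j))) ?_ ?_ ?_ ?_ ?_
    · rintro ⟨a, b⟩ hp
      simp only [Finset.mem_filter, Finset.mem_product, Fintype.mem_piFinset, this,
        Fin.append_left, Fin.append_right] at hp ⊢
      tauto
    · intro i hi
      simp only [Finset.mem_filter, Finset.mem_product, Fintype.mem_piFinset, this] at hi ⊢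
      tauto
    · rintro ⟨a, b⟩ _
      simp
    · intro i _
      exact Fin.append_castAdd_natAdd
    · rintro ⟨a, b⟩ hp
      simp only [(Finset.mem_filter.1 hp).2, if_true, Fin.append_left, Fin.append_right]
      ring
  · intro p hp hp'
    have : ¬ (∑ j, p.1 j + ∑ j, p.2 j = K) := fun h => hp' (Finset.mem_filter.2 ⟨hp, h⟩)
    simp [this]

/-- The bracket sum without the sorting of the tuples: multinomial coefficients count the
rearrangements of a sorted tuple and the binomial coefficient the sets of positions. -/
lemma bracket_eq_sum_mixedSum (m h l K : ℕ) (hl : l ≤ m) :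
    bracket m h l K = ∑ L ∈ (Finset.univ : Finset (Fin m)).powersetCard l,
      mixedSum m (fun i => numH m h i) (fun i => numE m h i) L K := by
  obtain ⟨n, rfl⟩ := Nat.exists_eq_add_of_le hl
  have hc : (Finset.univ.filter fun j : Fin (l + n) => j.val < l).card = l := by
    simp only [Finset.card_filter, Fin.sum_univ_add]
    simp
  rw [Finset.sum_congr rfl fun L hL => mixedSum_eq_of_card_eq _ _ _ K
      ((Finset.mem_powersetCard.1 hL).2.trans hc.symm),
    Finset.sum_const, Finset.card_powersetCard, smul_eq_mul, Finset.card_univ, Fintype.card_fin,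
    mixedSum_castAdd, Finset.sum_comm, bracket_eq_sum_monotone]
  congr 1
  rw [sum_symmetric_eq_sum_monotone]
  · refine Finset.sum_congr rfl fun b _ => ?_
    rw [← Finset.mul_sum, ← sum_symmetric_eq_sum_monotone]
    intro a σ
    have h1 : ∑ j, (a ∘ σ) j = ∑ j, a j := Equiv.sum_comp σ a
    have h2 : ∏ j, numH (l + n) h ((a ∘ σ) j) = ∏ j, numH (l + n) h (a j) :=
      Equiv.prod_comp σ fun j => numH (l + n) h (a j)
    rw [h1, h2]
  · intro b σ
    have h1 : ∑ j, (b ∘ σ) j = ∑ j, b j := Equiv.sum_comp σ b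
    have h2 : ∏ j, numE (l + n) h ((b ∘ σ) j) = ∏ j, numE (l + n) h (b j) :=
      Equiv.prod_comp σ fun j => numE (l + n) h (b j)
    simp only [h1, h2]

lemma bracket_of_neg (m h l : ℕ) {k : ℤ} (hk : k < 0) : bracket m h l k = 0 := by
  refine Finset.sum_eq_zero fun i hi => ?_
  have h1 := (Finset.mem_filter.1 hi).2.2.2
  have h2 : (0 : ℤ) ≤ ∑ j, (i j : ℤ) := Finset.sum_nonneg fun j _ => by positivity
  omega

/-! ### The observed set as a least stable set -/

section Closure

variable {V : Type*}

/-- No vertex is forced by `v` from the observed set `A`, when `v` itself is allowed to force: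
a neighbour `x` of `v` lies in `A` as soon as all other neighbours of `v` do. -/
def StableAt (G : SimpleGraph V) (A : Set V) (v : V) : Prop :=
  ∀ x, G.Adj v x → (∀ y, G.Adj v y → y ≠ x → y ∈ A) → x ∈ A

lemma StableAt.mono_of_neighbors {G : SimpleGraph V} {A B : Set V} {v : V} (h : StableAt G A v)
    (hAB : ∀ y, G.Adj v y → (y ∈ A ↔ y ∈ B)) : StableAt G B v := fun x hx hy =>
  (hAB x hx).1 (h x hx fun y hvy hyx => (hAB y hvy).2 (hy y hvy hyx))

lemma closedNbhd_mono (G : SimpleGraph V) {S T : Set V} (h : S ⊆ T) :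
    closedNbhd G S ⊆ closedNbhd G T := by
  rintro x (hx | ⟨v, hv, hvx⟩)
  · exact Or.inl (h hx)
  · exact Or.inr ⟨v, h hv, hvx⟩

lemma closedNbhd_subset_obs (G : SimpleGraph V) (S : Set V) : closedNbhd G S ⊆ obs G S :=
  fun _ hx => Set.mem_iUnion.2 ⟨0, hx⟩

lemma subset_obs (G : SimpleGraph V) (S : Set V) : S ⊆ obs G S :=
  fun _ hx => closedNbhd_subset_obs G S (Or.inl hx)

lemma mem_obs_of_adj {G : SimpleGraph V} {S : Set V} {v x : V} (hv : v ∈ S) (h : G.Adj v x) :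
    x ∈ obs G S :=
  closedNbhd_subset_obs G S (Or.inr ⟨v, hv, h⟩)

/-- `obs G S` is contained in every stable set containing the closed neighbourhood of `S`. -/
lemma obs_subset {G : SimpleGraph V} {S A : Set V} (h0 : closedNbhd G S ⊆ A)
    (hA : ∀ v ∈ A, StableAt G A v) : obs G S ⊆ A := by
  refine Set.iUnion_subset fun k => ?_
  induction k with
  | zero => exact h0
  | succ k ih =>
    refine Set.union_subset ih ?_
    rintro x ⟨v, hv, hvx⟩
    have hx : x ∈ G.neighborSet v \ propagation G S k := hvx ▸ rfl
    refine hA v (ih hv) x hx.1 fun y hy hyx => ?_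
    by_contra hyA
    have : y ∈ G.neighborSet v \ propagation G S k := ⟨hy, fun h => hyA (ih h)⟩
    rw [hvx] at this
    exact hyx this

lemma propagation_mono (G : SimpleGraph V) (S : Set V) : Monotone (propagation G S) :=
  monotone_nat_of_le_succ fun _ => Set.subset_union_left

lemma stableAt_obs [Finite V] (G : SimpleGraph V) (S : Set V) {v : V} (hv : v ∈ obs G S) :
    StableAt G (obs G S) v := by
  have hN : ∃ N, obs G S ⊆ propagation G S N := by
    have h : ∀ y : V, ∃ k, y ∈ obs G S → y ∈ propagation G S k := by
      intro y
      by_cases hy : y ∈ obs G S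
      · obtain ⟨k, hk⟩ := Set.mem_iUnion.1 hy
        exact ⟨k, fun _ => hk⟩
      · exact ⟨0, fun h => absurd h hy⟩
    choose f hf using h
    obtain ⟨N, hN⟩ := (Set.finite_range f).bddAbove
    exact ⟨N, fun y hy => propagation_mono G S (hN ⟨y, rfl⟩) (hf y hy)⟩
  obtain ⟨N, hN⟩ := hN
  intro x hx hy
  by_cases hxN : x ∈ propagation G S N
  · exact Set.mem_iUnion.2 ⟨N, hxN⟩
  refine Set.mem_iUnion.2 ⟨N + 1, Or.inr ⟨v, hN hv, ?_⟩⟩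
  ext y
  constructor
  · rintro ⟨hvy, hyN⟩
    by_contra hyx
    exact hyN (hN (hy y hvy hyx))
  · rintro rfl
    exact ⟨hx, hxN⟩

lemma obs_mono_of_closedNbhd [Finite V] {G : SimpleGraph V} {S T : Set V}
    (h : closedNbhd G S ⊆ obs G T) : obs G S ⊆ obs G T :=
  obs_subset h fun _ hv => stableAt_obs G T hv

lemma obs_mono [Finite V] (G : SimpleGraph V) {S T : Set V} (h : S ⊆ T) :
    obs G S ⊆ obs G T :=
  obs_mono_of_closedNbhd ((closedNbhd_mono G h).trans (closedNbhd_subset_obs G T))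

end Closure

/-! ### The copies of `T⁺_{m,h}` inside `T⁺_{m,h+1}` -/

section Tree

variable {m h : ℕ}

lemma extTree_adj_some_some {u v : TreeVertex m h} :
    (extTree m h).Adj (some u) (some v) ↔
      ∃ i : Fin m, v.1 = u.1 ++ [i] ∨ u.1 = v.1 ++ [i] := by
  have hne : ∀ i : Fin m, (v.1 = u.1 ++ [i] ∨ u.1 = v.1 ++ [i]) → u ≠ v := by
    rintro i (hi | hi) rfl <;> simp at hi
  simp only [extTree, SimpleGraph.sup_adj, SimpleGraph.edge_adj, stem, root]
  constructor
  · rintro (⟨-, a, b, ⟨-, hab⟩, ha, hb⟩ | ⟨hab, -⟩)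
    · cases ha
      cases hb
      rcases hab with ⟨i, hi⟩ | ⟨i, hi⟩
      exacts [⟨i, Or.inl hi⟩, ⟨i, Or.inr hi⟩]
    · simp at hab
  · rintro ⟨i, hi⟩
    exact Or.inl ⟨fun h => hne i hi (Option.some_injective _ h), u, v, ⟨hne i hi,
      hi.imp (fun h => ⟨i, h⟩) fun h => ⟨i, h⟩⟩, rfl, rfl⟩

lemma extTree_adj_stem {x : ExtVertex m h} : (extTree m h).Adj (stem m h) x ↔ x = root m h := by
  simp only [extTree, SimpleGraph.sup_adj, SimpleGraph.edge_adj, stem, root]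
  constructor
  · rintro (⟨-, a, b, -, ha, hb⟩ | ⟨hab, -⟩)
    · cases ha
    · rcases hab with ⟨h1, -⟩ | ⟨-, h1⟩
      · cases h1
      · exact h1
  · rintro rfl
    exact Or.inr ⟨Or.inr ⟨trivial, rfl⟩, by simp⟩

lemma extTree_adj_none_some {v : TreeVertex m h} :
    (extTree m h).Adj none (some v) ↔ v.1 = [] := by
  rw [show (none : ExtVertex m h) = stem m h from rfl, extTree_adj_stem, root, Option.some_inj,
    Subtype.ext_iff]
  rfl

lemma adj_root_stem : (extTree m h).Adj (root m h) (stem m h) :=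
  (extTree_adj_stem.2 rfl).symm

lemma root_ne_stem : root m h ≠ stem m h := Option.some_ne_none _

/-- The vertices of `T⁺_{m,h+1}` that form the copy of `T⁺_{m,h}` at the `i`-th child of the
root. The stem of the copy is the root of `T⁺_{m,h+1}`. -/
def emb (i : Fin m) : ExtVertex m h → ExtVertex m (h + 1)
  | none => root m (h + 1)
  | some w => some ⟨i :: w.1, Nat.succ_le_succ w.2⟩

lemma emb_stem (i : Fin m) : emb i (stem m h) = root m (h + 1) := rfl

lemma emb_ne_stem (i : Fin m) (x : ExtVertex m h) : emb i x ≠ stem m (h + 1) := by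
  cases x <;> exact Option.some_ne_none _

lemma emb_eq_root {i : Fin m} {x : ExtVertex m h} :
    emb i x = root m (h + 1) ↔ x = stem m h := by
  cases x with
  | none => simp [emb, stem]
  | some w => simp [emb, root, treeRoot, stem]

lemma emb_injective (i : Fin m) : Function.Injective (emb (h := h) i) := by
  intro x y hxy
  cases x <;> cases y <;> simp_all [emb, root, treeRoot, Subtype.ext_iff]

/-- Different copies share only the root. -/
lemma emb_eq_emb {i j : Fin m} {x y : ExtVertex m h} (hx : x ≠ stem m h)
    (hxy : emb i x = emb j y) : i = j ∧ x = y := by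
  have hij : i = j := by
    cases x <;> cases y <;> simp_all [emb, root, treeRoot, stem]
  subst hij
  exact ⟨rfl, emb_injective i hxy⟩

lemma extVertex_cases (x : ExtVertex m (h + 1)) :
    x = stem m (h + 1) ∨ x = root m (h + 1) ∨ ∃ i y, y ≠ stem m h ∧ x = emb i y := by
  rcases x with - | ⟨- | ⟨i, w⟩, hw⟩
  · exact Or.inl rfl
  · exact Or.inr (Or.inl rfl)
  · exact Or.inr (Or.inr ⟨i, some ⟨w, Nat.le_of_succ_le_succ hw⟩, Option.some_ne_none _, rfl⟩)

lemma adj_emb {i : Fin m} {x y : ExtVertex m h} :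
    (extTree m (h + 1)).Adj (emb i x) (emb i y) ↔ (extTree m h).Adj x y := by
  have key : ∀ v : TreeVertex m h, (extTree m (h + 1)).Adj (emb i none) (emb i (some v)) ↔
      (extTree m h).Adj none (some v) := by
    intro v
    rw [extTree_adj_none_some, emb, emb, root, extTree_adj_some_some]
    constructor
    · rintro ⟨j, hj | hj⟩
      · simp [treeRoot] at hj
        exact hj.2
      · simp [treeRoot] at hj
    · intro hv
      exact ⟨i, Or.inl (by simp [treeRoot, hv])⟩
  rcases x with - | u <;> rcases y with - | v
  · simp
  · exact key v
  · rw [SimpleGraph.adj_comm, key, SimpleGraph.adj_comm]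
  · rw [emb, emb, extTree_adj_some_some, extTree_adj_some_some]
    simp

lemma exists_eq_emb_of_adj {i : Fin m} {x : ExtVertex m h} (hx : x ≠ stem m h)
    {z : ExtVertex m (h + 1)} (hz : (extTree m (h + 1)).Adj (emb i x) z) :
    ∃ y, z = emb i y := by
  rcases x with - | u
  · exact absurd rfl hx
  rcases extVertex_cases z with rfl | rfl | ⟨j, y, hy, rfl⟩
  · rw [SimpleGraph.adj_comm, extTree_adj_stem, emb_eq_root] at hz
    exact absurd hz hx
  · exact ⟨none, rfl⟩
  · rcases y with - | v
    · exact absurd rfl hy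
    · rw [emb, emb, extTree_adj_some_some] at hz
      have : i = j := by
        obtain ⟨a, ha | ha⟩ := hz
        · simp at ha
          exact ha.1.symm
        · simp at ha
          exact ha.1
      subst this
      exact ⟨some v, rfl⟩

lemma adj_root_iff {z : ExtVertex m (h + 1)} : (extTree m (h + 1)).Adj (root m (h + 1)) z ↔
    z = stem m (h + 1) ∨ ∃ i : Fin m, z = emb i (root m h) := by
  constructor
  · intro hz
    rcases extVertex_cases z with rfl | rfl | ⟨j, y, hy, rfl⟩
    · exact Or.inl rfl
    · exact absurd hz (SimpleGraph.irrefl _)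
    · rw [← emb_stem j, adj_emb, extTree_adj_stem] at hz
      exact Or.inr ⟨j, by rw [hz]⟩
  · rintro (rfl | ⟨i, rfl⟩)
    · exact adj_root_stem
    · rw [← emb_stem i, adj_emb, extTree_adj_stem]

lemma adj_root_emb_root (i : Fin m) :
    (extTree m (h + 1)).Adj (root m (h + 1)) (emb i (root m h)) :=
  adj_root_iff.2 (Or.inr ⟨i, rfl⟩)

lemma stableAt_emb {A : Set (ExtVertex m (h + 1))} {i : Fin m} {x : ExtVertex m h}
    (hx : x ≠ stem m h) :
    StableAt (extTree m (h + 1)) A (emb i x) ↔ StableAt (extTree m h) (emb i ⁻¹' A) x := by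
  constructor
  · intro H y hy hz
    refine H (emb i y) (adj_emb.2 hy) fun z hxz hzy => ?_
    obtain ⟨w, rfl⟩ := exists_eq_emb_of_adj hx hxz
    exact hz w (adj_emb.1 hxz) fun hw => hzy (by rw [hw])
  · intro H y hy hz
    obtain ⟨w, rfl⟩ := exists_eq_emb_of_adj hx hy
    exact H w (adj_emb.1 hy) fun z hxz hzw =>
      hz _ (adj_emb.2 hxz) fun h => hzw (emb_injective i h)

lemma stableAt_stem {A : Set (ExtVertex m h)} :
    StableAt (extTree m h) A (stem m h) ↔ root m h ∈ A := by
  constructor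
  · intro H
    exact H _ (extTree_adj_stem.2 rfl) fun y hy hyx => absurd (extTree_adj_stem.1 hy) hyx
  · intro H x hx _
    rwa [extTree_adj_stem.1 hx]

/-- When the stem is not in `S`, forcing by the stem is irrelevant. -/
lemma obs_subset_of_stem_notMem {S A : Set (ExtVertex m h)} (hS : stem m h ∉ S)
    (h0 : closedNbhd (extTree m h) S ⊆ A)
    (hA : ∀ v ∈ A, v ≠ stem m h → StableAt (extTree m h) A v) : obs (extTree m h) S ⊆ A := by
  by_cases hr : root m h ∈ A
  · refine obs_subset h0 fun v hv => ?_
    by_cases hvs : v = stem m h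
    · subst hvs
      exact stableAt_stem.2 hr
    · exact hA v hv hvs
  · -- The stem can be removed from `A`: it is adjacent to no vertex of `A`.
    refine (obs_subset (A := A \ {stem m h}) ?_ ?_).trans Set.sdiff_subset
    · intro x hx
      refine ⟨h0 hx, ?_⟩
      rintro rfl
      rcases hx with hx | ⟨v, hv, hvx⟩
      · exact hS hx
      · rw [SimpleGraph.adj_comm, extTree_adj_stem] at hvx
        exact hr (h0 (Or.inl (hvx ▸ hv)))
    · rintro v ⟨hv, hvs⟩
      refine (hA v hv hvs).mono_of_neighbors fun y hy => ?_
      have : y ≠ stem m h := by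
        rintro rfl
        rw [SimpleGraph.adj_comm, extTree_adj_stem] at hy
        exact hr (hy ▸ hv)
      simp [this]

/-- The part of `S` below the `i`-th child of the root, as a set of vertices of `T⁺_{m,h}` that
does not contain the stem. -/
def restr (S : Set (ExtVertex m (h + 1))) (i : Fin m) : Set (ExtVertex m h) :=
  {x | x ≠ stem m h ∧ emb i x ∈ S}

lemma stem_notMem_restr (S : Set (ExtVertex m (h + 1))) (i : Fin m) :
    stem m h ∉ restr S i := fun H => H.1 rfl

lemma obs_restr_subset (S : Set (ExtVertex m (h + 1))) (i : Fin m) :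
    obs (extTree m h) (restr S i) ⊆ emb i ⁻¹' obs (extTree m (h + 1)) S := by
  refine obs_subset_of_stem_notMem (stem_notMem_restr S i) ?_ fun v hv hvs => ?_
  · rintro x (hx | ⟨v, hv, hvx⟩)
    · exact subset_obs _ _ hx.2
    · exact mem_obs_of_adj hv.2 (adj_emb.2 hvx)
  · exact (stableAt_emb hvs).1 (stableAt_obs _ _ hv)

lemma obs_restr_union_subset {S : Set (ExtVertex m (h + 1))} {i : Fin m}
    (hr : root m (h + 1) ∈ obs (extTree m (h + 1)) S)
    (hi : emb i (root m h) ∈ obs (extTree m (h + 1)) S) :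
    obs (extTree m h) (restr S i ∪ {stem m h}) ⊆ emb i ⁻¹' obs (extTree m (h + 1)) S := by
  refine obs_subset ?_ fun v hv => ?_
  · rintro x ((hx | rfl) | ⟨v, (hv | rfl), hvx⟩)
    · exact subset_obs _ _ hx.2
    · exact hr
    · exact mem_obs_of_adj hv.2 (adj_emb.2 hvx)
    · rw [extTree_adj_stem.1 hvx]
      exact hi
  · by_cases hvs : v = stem m h
    · subst hvs
      exact stableAt_stem.2 hi
    · exact (stableAt_emb hvs).1 (stableAt_obs _ _ hv)

/-- The union of a set `R` of vertices of `T⁺_{m,h+1}` and of the copies of sets `F i` of vertices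
of `T⁺_{m,h}`. -/
def glue (R : Set (ExtVertex m (h + 1))) (F : Fin m → Set (ExtVertex m h)) :
    Set (ExtVertex m (h + 1)) :=
  R ∪ ⋃ i, emb i '' F i

lemma emb_mem_glue {R : Set (ExtVertex m (h + 1))}
    {F : Fin m → Set (ExtVertex m h)} {i : Fin m} {x : ExtVertex m h} (hx : x ≠ stem m h) :
    emb i x ∈ glue R F ↔ emb i x ∈ R ∨ x ∈ F i := by
  constructor
  · rintro (H | H)
    · exact Or.inl H
    · obtain ⟨j, y, hy, hyx⟩ := Set.mem_iUnion.1 H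
      obtain ⟨rfl, rfl⟩ := emb_eq_emb hx hyx.symm
      exact Or.inr hy
  · rintro (H | H)
    · exact Or.inl H
    · exact Or.inr (Set.mem_iUnion.2 ⟨i, x, H, rfl⟩)

lemma root_mem_glue {R : Set (ExtVertex m (h + 1))} {F : Fin m → Set (ExtVertex m h)} :
    root m (h + 1) ∈ glue R F ↔ root m (h + 1) ∈ R ∨ ∃ i, stem m h ∈ F i := by
  constructor
  · rintro (H | H)
    · exact Or.inl H
    · obtain ⟨j, y, hy, hyx⟩ := Set.mem_iUnion.1 H
      exact Or.inr ⟨j, (emb_eq_root.1 hyx) ▸ hy⟩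
  · rintro (H | ⟨i, H⟩)
    · exact Or.inl H
    · exact Or.inr (Set.mem_iUnion.2 ⟨i, _, H, emb_stem i⟩)

lemma stem_mem_glue {R : Set (ExtVertex m (h + 1))} {F : Fin m → Set (ExtVertex m h)} :
    stem m (h + 1) ∈ glue R F ↔ stem m (h + 1) ∈ R := by
  constructor
  · rintro (H | H)
    · exact H
    · obtain ⟨j, y, hy, hyx⟩ := Set.mem_iUnion.1 H
      exact absurd hyx (emb_ne_stem j y)
  · exact Or.inl

end Tree

/-! ### Type I and Type II sets in terms of their parts -/

section Classification

variable {m h : ℕ}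

lemma IsPowerDominating.mono [Finite V] {G : SimpleGraph V} {S T : Set V} (h : S ⊆ T)
    (hS : IsPowerDominating G S) : IsPowerDominating G T :=
  Set.univ_subset_iff.1 (hS ▸ obs_mono G h)

lemma stableAt_of_two_missing {V : Type*} {G : SimpleGraph V} {A : Set V} {v y z : V} (hyz : y ≠ z)
    (hy : G.Adj v y) (hz : G.Adj v z) (hyA : y ∉ A) (hzA : z ∉ A) : StableAt G A v := by
  intro x _ H
  by_cases hxy : y = x
  · subst hxy
    exact absurd (H z hz hyz.symm) hzA
  · exact absurd (H y hy hxy) hyA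

/-- Once the stem is observed, adding it to `S` changes nothing. -/
lemma obs_union_stem_subset {S : Set (ExtVertex m h)}
    (hs : stem m h ∈ obs (extTree m h) S) :
    obs (extTree m h) (S ∪ {stem m h}) ⊆ obs (extTree m h) S := by
  refine obs_mono_of_closedNbhd ?_
  have hr : root m h ∈ obs (extTree m h) S := stableAt_stem.1 (stableAt_obs _ _ hs)
  rintro x ((hx | rfl) | ⟨v, (hv | rfl), hvx⟩)
  · exact subset_obs _ _ hx
  · exact hs
  · exact mem_obs_of_adj hv hvx
  · rwa [extTree_adj_stem.1 hvx]

lemma IsTypeII.stem_notMem_obs {S : Set (ExtVertex m h)} (hS : IsTypeII m h S) :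
    stem m h ∉ obs (extTree m h) S := fun hs =>
  hS.2.1 (Set.univ_subset_iff.1 (hS.2.2 ▸ obs_union_stem_subset hs))

lemma isTypeI_or_isTypeII_iff {S : Set (ExtVertex m h)} (hS : stem m h ∉ S) :
    IsTypeI m h S ∨ IsTypeII m h S ↔ IsPowerDominating (extTree m h) (S ∪ {stem m h}) := by
  constructor
  · rintro (H | H)
    · exact H.2.mono Set.subset_union_left
    · exact H.2.2
  · intro H
    by_cases hpd : IsPowerDominating (extTree m h) S
    · exact Or.inl ⟨hS, hpd⟩
    · exact Or.inr ⟨hS, hpd, H⟩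

lemma IsTypeI.mem_obs {S : Set (ExtVertex m h)} (hS : IsTypeI m h S) (x : ExtVertex m h) :
    x ∈ obs (extTree m h) S := by
  rw [hS.2]
  trivial

lemma eq_univ_of_emb {A : Set (ExtVertex m (h + 1))} (hs : stem m (h + 1) ∈ A)
    (hr : root m (h + 1) ∈ A) (hA : ∀ i, emb i ⁻¹' A = Set.univ) : A = Set.univ := by
  refine Set.eq_univ_of_forall fun x => ?_
  rcases extVertex_cases x with rfl | rfl | ⟨i, y, -, rfl⟩
  · exact hs
  · exact hr
  · exact Set.eq_univ_iff_forall.1 (hA i) y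

lemma restr_union_stem (S : Set (ExtVertex m (h + 1))) (i : Fin m) :
    restr (S ∪ {stem m (h + 1)}) i = restr S i := by
  ext x
  simp [restr, emb_ne_stem]

/-- An upper bound for the observed set of `T⁺_{m,h+1}`, glued from sets `F i` in the copies of
`T⁺_{m,h}`. Stability inside the copies is checked copy by copy, except at their common stem. -/
lemma obs_subset_glue {S R : Set (ExtVertex m (h + 1))} {F : Fin m → Set (ExtVertex m h)}
    (hRF : ∀ i, stem m h ∈ F i ↔ root m (h + 1) ∈ R)
    (hR : R ⊆ {stem m (h + 1), root m (h + 1)})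
    (hF0 : ∀ i, closedNbhd (extTree m h) (restr S i) ⊆ F i)
    (hF : ∀ i, ∀ v ∈ F i, v ≠ stem m h → StableAt (extTree m h) (F i) v)
    (hroot : root m (h + 1) ∈ R →
      StableAt (extTree m (h + 1)) (glue R F) (root m (h + 1)))
    (hstem : stem m (h + 1) ∈ R → root m (h + 1) ∈ R)
    (hrS : root m (h + 1) ∈ S →
      root m (h + 1) ∈ R ∧ stem m (h + 1) ∈ R ∧ ∀ i, root m h ∈ F i)
    (hsS : stem m (h + 1) ∈ S → stem m (h + 1) ∈ R) :
    obs (extTree m (h + 1)) S ⊆ glue R F := by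
  have hemb : ∀ i, emb i ⁻¹' glue R F = F i := by
    intro i
    ext x
    by_cases hx : x = stem m h
    · subst hx
      rw [Set.mem_preimage, emb_stem, root_mem_glue, hRF i]
      exact ⟨fun H => H.elim id fun ⟨j, hj⟩ => (hRF j).1 hj, Or.inl⟩
    · rw [Set.mem_preimage, emb_mem_glue hx]
      refine ⟨fun H => H.elim (fun hxR => ?_) id, Or.inr⟩
      rcases hR hxR with H | H
      · exact absurd H (emb_ne_stem i x)
      · exact absurd (emb_eq_root.1 H) hx
  have hmem : ∀ i x, x ∈ F i → emb i x ∈ glue R F := fun i x hx => by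
    rw [← hemb i] at hx
    exact hx
  refine obs_subset ?_ fun v hv => ?_
  · rintro x (hx | ⟨v, hv, hvx⟩)
    · rcases extVertex_cases x with rfl | rfl | ⟨i, y, hy, rfl⟩
      · exact Or.inl (hsS hx)
      · exact Or.inl (hrS hx).1
      · exact hmem i y (hF0 i (Or.inl ⟨hy, hx⟩))
    · rcases extVertex_cases v with rfl | rfl | ⟨i, y, hy, rfl⟩
      · rw [extTree_adj_stem.1 hvx]
        exact Or.inl (hstem (hsS hv))
      · rcases adj_root_iff.1 hvx with rfl | ⟨i, rfl⟩
        · exact Or.inl (hrS hv).2.1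
        · exact hmem i _ ((hrS hv).2.2 i)
      · obtain ⟨z, rfl⟩ := exists_eq_emb_of_adj hy hvx
        exact hmem i z (hF0 i (Or.inr ⟨y, ⟨hy, hv⟩, adj_emb.1 hvx⟩))
  · rcases extVertex_cases v with rfl | rfl | ⟨i, y, hy, rfl⟩
    · exact stableAt_stem.2 (Or.inl (hstem (stem_mem_glue.1 hv)))
    · refine hroot ?_
      rcases root_mem_glue.1 hv with H | ⟨i, H⟩
      exacts [H, (hRF i).1 H]
    · rw [stableAt_emb hy, hemb]
      refine hF i y ?_ hy
      rw [← hemb i]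
      exact hv

lemma restr_union_stem_isPowerDominating {S : Set (ExtVertex m (h + 1))}
    (hS : IsPowerDominating (extTree m (h + 1)) S) (i : Fin m) :
    IsPowerDominating (extTree m h) (restr S i ∪ {stem m h}) := by
  have hst : ∀ i, stem m h ∈ obs (extTree m h) (restr S i ∪ {stem m h}) := fun i =>
    subset_obs _ _ (Or.inr rfl)
  have hro : ∀ i, root m h ∈ obs (extTree m h) (restr S i ∪ {stem m h}) := fun i =>
    mem_obs_of_adj (Or.inr rfl) (extTree_adj_stem.2 rfl)
  have key : obs (extTree m (h + 1)) S ⊆ glue {stem m (h + 1), root m (h + 1)}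
      fun i => obs (extTree m h) (restr S i ∪ {stem m h}) := by
    refine obs_subset_glue (fun i => ⟨fun _ => Or.inr rfl, fun _ => hst i⟩) subset_rfl
      (fun i => (closedNbhd_mono _ Set.subset_union_left).trans (closedNbhd_subset_obs _ _))
      (fun i v hv _ => stableAt_obs _ _ hv) (fun _ x hx _ => ?_) (fun _ => Or.inr rfl)
      (fun _ => ⟨Or.inr rfl, Or.inl rfl, hro⟩) (fun _ => Or.inl rfl)
    rcases adj_root_iff.1 hx with rfl | ⟨j, rfl⟩
    · exact Or.inl (Or.inl rfl)
    · exact Or.inr (Set.mem_iUnion.2 ⟨j, _, hro j, rfl⟩)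
  refine Set.eq_univ_of_forall fun x => ?_
  by_cases hx : x = stem m h
  · subst hx
    exact hst i
  · rcases (emb_mem_glue hx).1 (key (hS.symm ▸ Set.mem_univ (emb i x))) with (H | H) | H
    · exact absurd H (emb_ne_stem i x)
    · exact absurd (emb_eq_root.1 H) hx
    · exact H

/-- In every set of Type I or II, the parts below the children of the root are of Type I or II. -/
lemma restr_isTypeI_or_isTypeII {S : Set (ExtVertex m (h + 1))}
    (hS : IsPowerDominating (extTree m (h + 1)) (S ∪ {stem m (h + 1)})) (i : Fin m) :
    IsTypeI m h (restr S i) ∨ IsTypeII m h (restr S i) := by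
  rw [isTypeI_or_isTypeII_iff (stem_notMem_restr S i), ← restr_union_stem]
  exact restr_union_stem_isPowerDominating hS i

lemma isTypeI_iff_of_root_mem {S : Set (ExtVertex m (h + 1))} (hs : stem m (h + 1) ∉ S)
    (hr : root m (h + 1) ∈ S) : IsTypeI m (h + 1) S ↔
      ∀ i, IsTypeI m h (restr S i) ∨ IsTypeII m h (restr S i) := by
  refine ⟨fun H => restr_isTypeI_or_isTypeII (H.2.mono Set.subset_union_left), fun H => ⟨hs, ?_⟩⟩
  refine eq_univ_of_emb (mem_obs_of_adj hr adj_root_stem) (subset_obs _ _ hr) fun i => ?_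
  refine Set.univ_subset_iff.1 (Eq.trans_subset ?_ (obs_restr_union_subset (subset_obs _ _ hr)
    (mem_obs_of_adj hr (adj_root_emb_root i))))
  exact ((isTypeI_or_isTypeII_iff (stem_notMem_restr S i)).1 (H i)).symm

lemma not_isTypeII_of_root_mem {S : Set (ExtVertex m h)}
    (hr : root m h ∈ S) : ¬ IsTypeII m h S := fun H =>
  H.stem_notMem_obs (mem_obs_of_adj hr adj_root_stem)

lemma root_mem_obs_of_isTypeI {S : Set (ExtVertex m (h + 1))} {i : Fin m}
    (hi : IsTypeI m h (restr S i)) : root m (h + 1) ∈ obs (extTree m (h + 1)) S :=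
  obs_restr_subset S i (hi.mem_obs (stem m h))

/-- If the root and its children are observed, then so is everything. -/
lemma isPowerDominating_of_root_mem_obs {S : Set (ExtVertex m (h + 1))}
    (H : ∀ i, IsPowerDominating (extTree m h) (restr S i ∪ {stem m h}))
    (hr : root m (h + 1) ∈ obs (extTree m (h + 1)) S)
    (hi : ∀ i, emb i (root m h) ∈ obs (extTree m (h + 1)) S) :
    IsPowerDominating (extTree m (h + 1)) S := by
  refine eq_univ_of_emb ?_ hr fun i => ?_
  · refine stableAt_obs _ _ hr _ adj_root_stem fun y hy hys => ?_
    rcases adj_root_iff.1 hy with rfl | ⟨j, rfl⟩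
    · exact absurd rfl hys
    · exact hi j
  · exact Set.univ_subset_iff.1 ((H i).symm.trans_subset (obs_restr_union_subset hr (hi i)))

/-- If the root of `T⁺_{m,h}` is not observed, observing the stem (without letting it
dominate its neighbour) triggers nothing. -/
lemma stableAt_obs_union_stem {X : Set (ExtVertex m h)}
    (hX : root m h ∈ obs (extTree m h) X → stem m h ∈ obs (extTree m h) X) {v : ExtVertex m h}
    (hv : v ∈ obs (extTree m h) X ∪ {stem m h}) (hvs : v ≠ stem m h) :
    StableAt (extTree m h) (obs (extTree m h) X ∪ {stem m h}) v := by
  have hv' : v ∈ obs (extTree m h) X := hv.resolve_right hvs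
  refine (stableAt_obs _ X hv').mono_of_neighbors fun y hvy => ?_
  refine ⟨Or.inl, fun H => H.elim id fun hy => ?_⟩
  obtain rfl : y = stem m h := hy
  rw [SimpleGraph.adj_comm, extTree_adj_stem] at hvy
  exact hX (hvy ▸ hv')

lemma restr_root_imp_stem (hP : ∀ X, IsTypeII m h X → root m h ∉ obs (extTree m h) X)
    {X : Set (ExtVertex m h)} (H : IsTypeI m h X ∨ IsTypeII m h X)
    (hr : root m h ∈ obs (extTree m h) X) : stem m h ∈ obs (extTree m h) X := by
  rcases H with H | H
  · exact H.mem_obs _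
  · exact absurd hr (hP X H)

lemma isTypeI_of_forall_isTypeI {S : Set (ExtVertex m (h + 1))} (hm : 0 < m)
    (hs : stem m (h + 1) ∉ S) (H : ∀ i, IsTypeI m h (restr S i)) : IsTypeI m (h + 1) S :=
  ⟨hs, isPowerDominating_of_root_mem_obs (fun i => (H i).2.mono Set.subset_union_left)
    (root_mem_obs_of_isTypeI (H ⟨0, hm⟩)) fun i => obs_restr_subset S i ((H i).mem_obs _)⟩

/-- With a single part of Type II, whose root is not observed, the root of the whole tree is
observed and has two unobserved neighbours, the stem being one of them. -/
lemma isTypeII_of_one_isTypeII (hP : ∀ X, IsTypeII m h X → root m h ∉ obs (extTree m h) X)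
    {S : Set (ExtVertex m (h + 1))} (hs : stem m (h + 1) ∉ S) (hr : root m (h + 1) ∉ S)
    {i₀ i₁ : Fin m} (h₀ : IsTypeII m h (restr S i₀)) (h₁ : i₁ ≠ i₀)
    (H : ∀ i, i ≠ i₀ → IsTypeI m h (restr S i)) :
    IsTypeII m (h + 1) S ∧ root m (h + 1) ∈ obs (extTree m (h + 1)) S ∧
      emb i₀ (root m h) ∉ obs (extTree m (h + 1)) S := by
  have hgood : ∀ i, IsTypeI m h (restr S i) ∨ IsTypeII m h (restr S i) := by
    intro i
    by_cases hi : i = i₀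
    · subst hi
      exact Or.inr h₀
    · exact Or.inl (H i hi)
  have hr₀ : emb i₀ (root m h) ∉ glue {root m (h + 1)}
      fun i => obs (extTree m h) (restr S i) ∪ {stem m h} := by
    rw [emb_mem_glue root_ne_stem]
    rintro (H | H | H)
    · exact root_ne_stem (emb_eq_root.1 H)
    · exact hP _ h₀ H
    · exact root_ne_stem H
  have hs₀ : stem m (h + 1) ∉ glue {root m (h + 1)}
      fun i => obs (extTree m h) (restr S i) ∪ {stem m h} := by
    rw [stem_mem_glue]
    exact fun H => root_ne_stem H.symm
  have key : obs (extTree m (h + 1)) S ⊆ glue {root m (h + 1)}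
      fun i => obs (extTree m h) (restr S i) ∪ {stem m h} :=
    obs_subset_glue (fun i => ⟨fun _ => rfl, fun _ => Or.inr rfl⟩)
      (fun x hx => Or.inr hx)
      (fun i => (closedNbhd_subset_obs _ _).trans Set.subset_union_left)
      (fun i v hv hvs => stableAt_obs_union_stem (restr_root_imp_stem hP (hgood i)) hv hvs)
      (fun _ => stableAt_of_two_missing (emb_ne_stem i₀ _) (adj_root_emb_root i₀) adj_root_stem
        hr₀ hs₀)
      (fun hx => absurd hx.symm root_ne_stem) (fun hx => absurd hx hr) (fun hx => absurd hx hs)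
  have hroot := root_mem_obs_of_isTypeI (H i₁ h₁)
  refine ⟨⟨hs, fun hpd => hs₀ (key (hpd.symm ▸ Set.mem_univ _)), ?_⟩, hroot,
    fun hx => hr₀ (key hx)⟩
  have hsub := obs_mono (extTree m (h + 1)) (S := S) (T := S ∪ {stem m (h + 1)})
    Set.subset_union_left
  have hchild : ∀ i, i ≠ i₀ →
      emb i (root m h) ∈ obs (extTree m (h + 1)) (S ∪ {stem m (h + 1)}) :=
    fun i hi => hsub (obs_restr_subset S i ((H i hi).mem_obs _))
  refine isPowerDominating_of_root_mem_obs (fun i => ?_) (hsub hroot) fun i => ?_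
  · rw [restr_union_stem]
    exact (isTypeI_or_isTypeII_iff (stem_notMem_restr S i)).1 (hgood i)
  · by_cases hi : i = i₀
    · subst hi
      -- All other neighbours of the root are observed, so the root forces its child.
      refine stableAt_obs _ _ (hsub hroot) _ (adj_root_emb_root i) fun y hy hyi => ?_
      rcases adj_root_iff.1 hy with rfl | ⟨j, rfl⟩
      · exact subset_obs _ _ (Or.inr rfl)
      · exact hchild j fun hj => hyi (by rw [hj])
    · exact hchild i hi

lemma not_isPowerDominating_of_two_isTypeII
    (hP : ∀ X, IsTypeII m h X → root m h ∉ obs (extTree m h) X)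
    {S : Set (ExtVertex m (h + 1))} (hr : root m (h + 1) ∉ S)
    {i₀ i₁ : Fin m} (h₀ : IsTypeII m h (restr S i₀)) (h₁ : IsTypeII m h (restr S i₁))
    (hne : i₀ ≠ i₁) (H : ∀ i, IsTypeI m h (restr S i) ∨ IsTypeII m h (restr S i)) :
    ¬ IsPowerDominating (extTree m (h + 1)) (S ∪ {stem m (h + 1)}) := by
  have hr₀ : ∀ i, IsTypeII m h (restr S i) →
      emb i (root m h) ∉ glue {stem m (h + 1), root m (h + 1)}
        fun i => obs (extTree m h) (restr S i) ∪ {stem m h} := by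
    intro i hi
    rw [emb_mem_glue root_ne_stem]
    rintro ((H | H) | H | H)
    · exact emb_ne_stem _ _ H
    · exact root_ne_stem (emb_eq_root.1 H)
    · exact hP _ hi H
    · exact root_ne_stem H
  have key : obs (extTree m (h + 1)) (S ∪ {stem m (h + 1)}) ⊆
      glue {stem m (h + 1), root m (h + 1)}
        fun i => obs (extTree m h) (restr S i) ∪ {stem m h} := by
    refine obs_subset_glue (fun i => ⟨fun _ => Or.inr rfl, fun _ => Or.inr rfl⟩) subset_rfl
      (fun i => ?_)
      (fun i v hv hvs => stableAt_obs_union_stem (restr_root_imp_stem hP (H i)) hv hvs)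
      (fun _ => stableAt_of_two_missing (fun he => hne (emb_eq_emb root_ne_stem he).1)
        (adj_root_emb_root i₀) (adj_root_emb_root i₁) (hr₀ i₀ h₀) (hr₀ i₁ h₁))
      (fun _ => Or.inr rfl) (fun hx => ?_) (fun _ => Or.inl rfl)
    · rw [restr_union_stem]
      exact (closedNbhd_subset_obs _ _).trans Set.subset_union_left
    · exact absurd hx (fun hx => hx.elim hr root_ne_stem)
  exact fun hpd => hr₀ i₀ h₀ (key (hpd.symm ▸ Set.mem_univ _))

lemma isTypeI_of_exists_isTypeI (hQ : ∀ X, IsTypeII m h X → root m h ∈ obs (extTree m h) X)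
    {S : Set (ExtVertex m (h + 1))} (hs : stem m (h + 1) ∉ S) {i₀ : Fin m}
    (h₀ : IsTypeI m h (restr S i₀))
    (H : ∀ i, IsTypeI m h (restr S i) ∨ IsTypeII m h (restr S i)) : IsTypeI m (h + 1) S :=
  ⟨hs, isPowerDominating_of_root_mem_obs
    (fun i => (isTypeI_or_isTypeII_iff (stem_notMem_restr S i)).1 (H i))
    (root_mem_obs_of_isTypeI h₀)
    fun i => obs_restr_subset S i ((H i).elim (fun hi => hi.mem_obs _) (hQ _))⟩

/-- If all parts are of Type II with their roots observed, then the observed set is the union of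
those of the parts, and the root of the whole tree is not observed. -/
lemma isTypeII_of_forall_isTypeII
    (hQ : ∀ X, IsTypeII m h X → root m h ∈ obs (extTree m h) X)
    {S : Set (ExtVertex m (h + 1))} (hs : stem m (h + 1) ∉ S) (hr : root m (h + 1) ∉ S)
    (H : ∀ i, IsTypeII m h (restr S i)) :
    IsTypeII m (h + 1) S ∧ root m (h + 1) ∉ obs (extTree m (h + 1)) S := by
  have key : obs (extTree m (h + 1)) S ⊆ glue ∅ fun i => obs (extTree m h) (restr S i) :=
    obs_subset_glue (fun i => ⟨fun hx => absurd hx (H i).stem_notMem_obs, fun hx => hx.elim⟩)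
      (Set.empty_subset _) (fun i => closedNbhd_subset_obs _ _)
      (fun i v hv _ => stableAt_obs _ _ hv) (fun hx => hx.elim) (fun hx => hx.elim)
      (fun hx => absurd hx hr) (fun hx => absurd hx hs)
  have hroot : root m (h + 1) ∉ obs (extTree m (h + 1)) S := by
    intro hx
    rcases root_mem_glue.1 (key hx) with hx | ⟨i, hx⟩
    · exact hx
    · exact (H i).stem_notMem_obs hx
  refine ⟨⟨hs, fun hpd => hroot (hpd.symm ▸ Set.mem_univ _), ?_⟩, hroot⟩
  refine isPowerDominating_of_root_mem_obs (fun i => ?_)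
    (mem_obs_of_adj (Or.inr rfl) (extTree_adj_stem.2 rfl))
    fun i => obs_mono _ Set.subset_union_left (obs_restr_subset S i (hQ _ (H i)))
  rw [restr_union_stem]
  exact (H i).2.2

lemma IsTypeI.not_isTypeII {S : Set (ExtVertex m h)} (hS : IsTypeI m h S) :
    ¬ IsTypeII m h S := fun H => H.2.1 hS.2

lemma isTypeI_succ_iff_forall (hm : 2 ≤ m)
    (hP : ∀ X, IsTypeII m h X → root m h ∉ obs (extTree m h) X)
    {S : Set (ExtVertex m (h + 1))} (hs : stem m (h + 1) ∉ S) (hr : root m (h + 1) ∉ S) :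
    IsTypeI m (h + 1) S ↔ ∀ i, IsTypeI m h (restr S i) := by
  refine ⟨fun H => ?_, isTypeI_of_forall_isTypeI (by omega) hs⟩
  have hpd := H.2.mono (Set.subset_union_left (t := {stem m (h + 1)}))
  have hgood := restr_isTypeI_or_isTypeII hpd
  by_contra! hc
  obtain ⟨i₀, hi₀⟩ := hc
  have h₀ := (hgood i₀).resolve_left hi₀
  by_cases h₁ : ∃ i, i₀ ≠ i ∧ IsTypeII m h (restr S i)
  · obtain ⟨i₁, hne, h₁⟩ := h₁
    exact not_isPowerDominating_of_two_isTypeII hP hr h₀ h₁ hne hgood hpd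
  · push Not at h₁
    have : Nontrivial (Fin m) := Fin.nontrivial_iff_two_le.2 hm
    obtain ⟨i₁, hne⟩ := exists_ne i₀
    exact H.not_isTypeII (isTypeII_of_one_isTypeII hP hs hr h₀ hne
      fun i hi => (hgood i).resolve_right (h₁ i hi.symm)).1

lemma isTypeII_succ_iff_exists_unique (hm : 2 ≤ m)
    (hP : ∀ X, IsTypeII m h X → root m h ∉ obs (extTree m h) X)
    {S : Set (ExtVertex m (h + 1))} (hs : stem m (h + 1) ∉ S) (hr : root m (h + 1) ∉ S) :
    IsTypeII m (h + 1) S ↔ ∃ i₀, IsTypeII m h (restr S i₀) ∧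
      ∀ i, i ≠ i₀ → IsTypeI m h (restr S i) := by
  constructor
  · intro H
    have hgood := restr_isTypeI_or_isTypeII H.2.2
    have h₀ : ∃ i₀, IsTypeII m h (restr S i₀) := by
      by_contra! hc
      exact (isTypeI_of_forall_isTypeI (by omega) hs
        fun i => (hgood i).resolve_right (hc i)).not_isTypeII H
    obtain ⟨i₀, h₀⟩ := h₀
    refine ⟨i₀, h₀, fun i hi => (hgood i).resolve_right fun h₁ => ?_⟩
    exact not_isPowerDominating_of_two_isTypeII hP hr h₀ h₁ hi.symm hgood H.2.2
  · rintro ⟨i₀, h₀, H⟩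
    have : Nontrivial (Fin m) := Fin.nontrivial_iff_two_le.2 hm
    obtain ⟨i₁, hne⟩ := exists_ne i₀
    exact (isTypeII_of_one_isTypeII hP hs hr h₀ hne H).1

lemma isTypeI_succ_iff_exists
    (hQ : ∀ X, IsTypeII m h X → root m h ∈ obs (extTree m h) X)
    {S : Set (ExtVertex m (h + 1))} (hs : stem m (h + 1) ∉ S) (hr : root m (h + 1) ∉ S) :
    IsTypeI m (h + 1) S ↔ (∀ i, IsTypeI m h (restr S i) ∨ IsTypeII m h (restr S i)) ∧
      ∃ i, IsTypeI m h (restr S i) := by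
  constructor
  · intro H
    have hgood := restr_isTypeI_or_isTypeII (H.2.mono Set.subset_union_left)
    refine ⟨hgood, ?_⟩
    by_contra! hc
    exact H.not_isTypeII (isTypeII_of_forall_isTypeII hQ hs hr
      fun i => (hgood i).resolve_left (hc i)).1
  · rintro ⟨hgood, i₀, h₀⟩
    exact isTypeI_of_exists_isTypeI hQ hs h₀ hgood

lemma isTypeII_succ_iff_forall
    (hQ : ∀ X, IsTypeII m h X → root m h ∈ obs (extTree m h) X)
    {S : Set (ExtVertex m (h + 1))} (hs : stem m (h + 1) ∉ S) (hr : root m (h + 1) ∉ S) :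
    IsTypeII m (h + 1) S ↔ ∀ i, IsTypeII m h (restr S i) := by
  refine ⟨fun H i => ?_, fun H => (isTypeII_of_forall_isTypeII hQ hs hr H).1⟩
  have hgood := restr_isTypeI_or_isTypeII H.2.2
  exact (hgood i).resolve_left fun hi => (isTypeI_of_exists_isTypeI hQ hs hi hgood).not_isTypeII H

/-- For a Type II set, the root is observed exactly when the height is odd. -/
lemma IsTypeII.root_mem_obs_iff (hm : 2 ≤ m) {S : Set (ExtVertex m h)} (hS : IsTypeII m h S) :
    root m h ∈ obs (extTree m h) S ↔ Odd h := by
  induction h with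
  | zero =>
    refine iff_of_false (fun hr => ?_) (by simp)
    refine hS.stem_notMem_obs (stableAt_obs _ _ hr _ adj_root_stem fun y _ hy => ?_)
    obtain rfl : y = root m 0 := by
      rcases y with - | ⟨w, hw⟩
      · exact absurd rfl hy
      · simp [root, treeRoot, List.length_eq_zero_iff.1 (Nat.le_zero.1 hw)]
    exact hr
  | succ h ih =>
    have hr : root m (h + 1) ∉ S := fun hr => not_isTypeII_of_root_mem hr hS
    rw [Nat.odd_add_one]
    by_cases hodd : Odd h
    · have hQ : ∀ X, IsTypeII m h X → root m h ∈ obs (extTree m h) X :=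
        fun X hX => (ih hX).2 hodd
      exact iff_of_false (isTypeII_of_forall_isTypeII hQ hS.1 hr
        ((isTypeII_succ_iff_forall hQ hS.1 hr).1 hS)).2 (not_not.2 hodd)
    · have hP : ∀ X, IsTypeII m h X → root m h ∉ obs (extTree m h) X :=
        fun X hX hX' => hodd ((ih hX).1 hX')
      obtain ⟨i₀, -, H⟩ := (isTypeII_succ_iff_exists_unique hm hP hS.1 hr).1 hS
      have : Nontrivial (Fin m) := Fin.nontrivial_iff_two_le.2 hm
      obtain ⟨i₁, hne⟩ := exists_ne i₀
      exact iff_of_true (root_mem_obs_of_isTypeI (H i₁ hne)) hodd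

lemma mem_closedNbhd_root {x : ExtVertex m (h + 1)} :
    x ∈ closedNbhd (extTree m (h + 1)) {root m (h + 1)} ↔
      x = root m (h + 1) ∨ x = stem m (h + 1) ∨ ∃ i, x = emb i (root m h) := by
  simp [closedNbhd, adj_root_iff]

lemma IsTypeII.closedNbhd_diff_obs_of_even (hm : 2 ≤ m) (hh : Even h)
    {S : Set (ExtVertex m (h + 1))} (hS : IsTypeII m (h + 1) S) :
    ∃ i : Fin m, closedNbhd (extTree m (h + 1)) {root m (h + 1)} \ obs (extTree m (h + 1)) S =
      {stem m (h + 1), emb i (root m h)} := by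
  have hr : root m (h + 1) ∉ S := fun hr => not_isTypeII_of_root_mem hr hS
  have hP : ∀ X, IsTypeII m h X → root m h ∉ obs (extTree m h) X := fun X hX hX' =>
    Nat.not_odd_iff_even.2 hh ((hX.root_mem_obs_iff hm).1 hX')
  obtain ⟨i₀, h₀, H⟩ := (isTypeII_succ_iff_exists_unique hm hP hS.1 hr).1 hS
  have : Nontrivial (Fin m) := Fin.nontrivial_iff_two_le.2 hm
  obtain ⟨i₁, hne⟩ := exists_ne i₀
  obtain ⟨-, hroot, hchild⟩ := isTypeII_of_one_isTypeII hP hS.1 hr h₀ hne H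
  refine ⟨i₀, ?_⟩
  ext x
  rw [Set.mem_sdiff, mem_closedNbhd_root]
  constructor
  · rintro ⟨rfl | rfl | ⟨i, rfl⟩, hx⟩
    · exact absurd hroot hx
    · exact Or.inl rfl
    · by_cases hi : i = i₀
      · subst hi
        exact Or.inr rfl
      · exact absurd (obs_restr_subset S i ((H i hi).mem_obs _)) hx
  · rintro (rfl | rfl)
    · exact ⟨Or.inr (Or.inl rfl), hS.stem_notMem_obs⟩
    · exact ⟨Or.inr (Or.inr ⟨i₀, rfl⟩), hchild⟩

lemma IsTypeII.closedNbhd_diff_obs_of_odd (hm : 2 ≤ m) (hh : Odd h)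
    {S : Set (ExtVertex m (h + 1))} (hS : IsTypeII m (h + 1) S) :
    closedNbhd (extTree m (h + 1)) {root m (h + 1)} \ obs (extTree m (h + 1)) S =
      {stem m (h + 1), root m (h + 1)} := by
  have hr : root m (h + 1) ∉ S := fun hr => not_isTypeII_of_root_mem hr hS
  have hQ : ∀ X, IsTypeII m h X → root m h ∈ obs (extTree m h) X := fun X hX =>
    (hX.root_mem_obs_iff hm).2 hh
  have H := (isTypeII_succ_iff_forall hQ hS.1 hr).1 hS
  ext x
  rw [Set.mem_sdiff, mem_closedNbhd_root]
  constructor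
  · rintro ⟨rfl | rfl | ⟨i, rfl⟩, hx⟩
    · exact Or.inr rfl
    · exact Or.inl rfl
    · exact absurd (obs_restr_subset S i (hQ _ (H i))) hx
  · rintro (rfl | rfl)
    · exact ⟨Or.inr (Or.inl rfl), hS.stem_notMem_obs⟩
    · exact ⟨Or.inl rfl, (isTypeII_of_forall_isTypeII hQ hS.1 hr H).2⟩

end Classification

/-! ### Counting by families of parts -/

section Counting

variable {m h : ℕ}

/-- The families of sets of Type I or II for `T⁺_{m,h}`, one for each child of the root of
`T⁺_{m,h+1}`, with `l` members of Type II and total size `k`. -/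
def families (m h l : ℕ) (k : ℤ) : Set (Fin m → Set (ExtVertex m h)) :=
  {F | (∀ i, IsTypeI m h (F i) ∨ IsTypeII m h (F i)) ∧ {i | IsTypeII m h (F i)}.ncard = l ∧
    ∑ i, ((F i).ncard : ℤ) = k}

/-- The families with prescribed set `L` of indices of the members of Type II. -/
lemma ncard_families_eq_mixedSum (L : Finset (Fin m)) (K : ℕ) :
    {F : Fin m → Set (ExtVertex m h) |
      (∀ i, if i ∈ L then IsTypeII m h (F i) else IsTypeI m h (F i)) ∧
        ∑ i, (F i).ncard = K}.ncard =
      mixedSum m (fun i => numH m h i) (fun i => numE m h i) L K := by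
  classical
  have := Fintype.ofFinite (Set (ExtVertex m h))
  rw [Set.ncard_eq_toFinset_card', mixedSum, ← Finset.sum_filter,
    Finset.card_eq_sum_card_fiberwise (f := fun F i => (F i).ncard)
      (t := (Fintype.piFinset fun _ : Fin m => Finset.range (K + 1)).filter
        fun i => ∑ j, i j = K)]
  · refine Finset.sum_congr rfl fun t ht => ?_
    have ht' : ∑ j, t j = K := (Finset.mem_filter.1 ht).2
    have : Finset.filter (fun F : Fin m → Set (ExtVertex m h) => (fun i => (F i).ncard) = t)
        {F : Fin m → Set (ExtVertex m h) |
          (∀ i, if i ∈ L then IsTypeII m h (F i) else IsTypeI m h (F i)) ∧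
            ∑ i, (F i).ncard = K}.toFinset =
        Fintype.piFinset fun i => {S : Set (ExtVertex m h) |
          (if i ∈ L then IsTypeII m h S else IsTypeI m h S) ∧ S.ncard = t i}.toFinset := by
      ext F
      simp only [Finset.mem_filter, Set.mem_toFinset, Set.mem_ofPred_eq, Fintype.mem_piFinset]
      constructor
      · rintro ⟨⟨h1, -⟩, rfl⟩ i
        exact ⟨h1 i, rfl⟩
      · intro H
        obtain rfl : (fun i => (F i).ncard) = t := funext fun i => (H i).2
        exact ⟨⟨fun i => (H i).1, ht'⟩, rfl⟩
    rw [this, Fintype.card_piFinset]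
    refine Finset.prod_congr rfl fun i _ => ?_
    rw [← Set.ncard_eq_toFinset_card']
    split_ifs with hi <;> simp [numH, numE]
  · intro F hF
    have hF' : ∑ i, (F i).ncard = K := (Set.mem_toFinset.1 hF).2
    simp only [Finset.coe_filter, Set.mem_ofPred_eq, Fintype.mem_piFinset, Finset.mem_range]
    refine ⟨fun i => ?_, hF'⟩
    rw [← hF', Nat.lt_succ_iff]
    exact Finset.single_le_sum (f := fun i => (F i).ncard) (fun _ _ => Nat.zero_le _)
      (Finset.mem_univ i)

lemma ncard_families (l : ℕ) (hl : l ≤ m) (k : ℤ) :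
    (families m h l k).ncard = bracket m h l k := by
  classical
  have := Fintype.ofFinite (Set (ExtVertex m h))
  rcases lt_or_ge k 0 with hk | hk
  · rw [bracket_of_neg m h l hk, Set.ncard_eq_zero (Set.toFinite _)]
    refine Set.eq_empty_of_forall_notMem fun F hF => ?_
    have h2 : (0 : ℤ) ≤ ∑ i, ((F i).ncard : ℤ) := Finset.sum_nonneg fun j _ => by positivity
    have := hF.2.2
    omega
  obtain ⟨K, rfl⟩ := Int.eq_ofNat_of_zero_le hk
  rw [bracket_eq_sum_mixedSum m h l K hl, Set.ncard_eq_toFinset_card',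
    Finset.card_eq_sum_card_fiberwise
      (f := fun F => Finset.univ.filter fun i => IsTypeII m h (F i))
      (t := (Finset.univ : Finset (Fin m)).powersetCard l)]
  · refine Finset.sum_congr rfl fun L hL => ?_
    rw [← ncard_families_eq_mixedSum, Set.ncard_eq_toFinset_card']
    congr 1
    ext F
    simp only [Finset.mem_filter, Set.mem_toFinset]
    constructor
    · rintro ⟨⟨h1, -, h3⟩, rfl⟩
      refine ⟨fun i => ?_, by exact_mod_cast h3⟩
      by_cases hi : IsTypeII m h (F i)
      · simp [hi]
      · simpa [hi] using (h1 i).resolve_right hi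
    · rintro ⟨h1, h2⟩
      have hL' : ∀ i, IsTypeII m h (F i) ↔ i ∈ L := by
        intro i
        have h1i := h1 i
        split_ifs at h1i with hi
        · exact iff_of_true h1i hi
        · exact iff_of_false h1i.not_isTypeII hi
      refine ⟨⟨fun i => ?_, ?_, by exact_mod_cast h2⟩, ?_⟩
      · have h1i := h1 i
        split_ifs at h1i
        exacts [Or.inr h1i, Or.inl h1i]
      · simp only [hL']
        rw [show {i | i ∈ L} = (L : Set (Fin m)) from rfl, Set.ncard_coe_finset]
        exact (Finset.mem_powersetCard.1 hL).2
      · ext i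
        simp [hL']
  · intro F hF
    have hF' := (Set.mem_toFinset.1 hF).2.1
    rw [Set.ncard_eq_toFinset_card'] at hF'
    rw [Finset.mem_coe, Finset.mem_powersetCard]
    refine ⟨Finset.subset_univ _, ?_⟩
    rw [← hF']
    congr 1
    ext i
    simp

/-- The families with fewer than `N` members of Type II, sorted by the number of these members. -/
lemma ncard_families_lt (N : ℕ) (k : ℤ) :
    {F : Fin m → Set (ExtVertex m h) | (∀ i, IsTypeI m h (F i) ∨ IsTypeII m h (F i)) ∧
      {i | IsTypeII m h (F i)}.ncard < N ∧ ∑ i, ((F i).ncard : ℤ) = k}.ncard =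
      ∑ l ∈ Finset.range N, (families m h l k).ncard := by
  classical
  have := Fintype.ofFinite (Set (ExtVertex m h))
  rw [Set.ncard_eq_toFinset_card', Finset.card_eq_sum_card_fiberwise
    (f := fun F => {i | IsTypeII m h (F i)}.ncard) (t := Finset.range N)]
  · refine Finset.sum_congr rfl fun l hl => ?_
    rw [Set.ncard_eq_toFinset_card']
    congr 1
    ext F
    have := Finset.mem_range.1 hl
    simp only [Finset.mem_filter, Set.mem_toFinset]
    constructor
    · rintro ⟨⟨h1, -, h3⟩, h2⟩
      exact ⟨h1, h2, h3⟩
    · rintro ⟨h1, h2, h3⟩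
      exact ⟨⟨h1, by omega, h3⟩, h2⟩
  · intro F hF
    exact Finset.mem_coe.2 (Finset.mem_range.2 (Set.mem_toFinset.1 hF).2.1)

lemma glue_restr {S : Set (ExtVertex m (h + 1))} (hs : stem m (h + 1) ∉ S) :
    glue (S ∩ {root m (h + 1)}) (restr S) = S := by
  ext x
  rcases extVertex_cases x with rfl | rfl | ⟨i, y, hy, rfl⟩
  · rw [stem_mem_glue]
    exact iff_of_false (fun H => hs H.1) hs
  · rw [root_mem_glue]
    exact ⟨fun H => H.elim (fun H => H.1) fun ⟨i, H⟩ => absurd H (stem_notMem_restr S i),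
      fun H => Or.inl ⟨H, rfl⟩⟩
  · rw [emb_mem_glue hy]
    exact ⟨fun H => H.elim (fun H => H.1) fun H => H.2, fun H => Or.inr ⟨hy, H⟩⟩

lemma ncard_eq_add_sum_restr {S : Set (ExtVertex m (h + 1))} (hs : stem m (h + 1) ∉ S) :
    S.ncard = (S ∩ {root m (h + 1)}).ncard + ∑ i, (restr S i).ncard := by
  conv_lhs => rw [← glue_restr hs, glue]
  rw [Set.ncard_union_eq _ (Set.toFinite _) (Set.toFinite _),
    Set.ncard_iUnion_of_finite (fun i => Set.toFinite _), finsum_eq_sum_of_fintype]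
  · simp only [Set.ncard_image_of_injective _ (emb_injective _)]
  · intro i j hij
    refine Set.disjoint_left.2 ?_
    rintro - ⟨x, hx, rfl⟩ ⟨y, -, hxy⟩
    exact hij (emb_eq_emb hx.1 hxy.symm).1
  · refine Set.disjoint_left.2 ?_
    rintro x ⟨-, rfl⟩ hx
    obtain ⟨i, y, hy, hyx⟩ := Set.mem_iUnion.1 hx
    exact hy.1 (emb_eq_root.1 hyx)

/-- A set without the stem is determined by whether it contains the root and by its parts below
the children of the root, and these can be prescribed. -/
lemma ncard_restr_preimage (p : Prop) (Q : (Fin m → Set (ExtVertex m h)) → Prop)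
    (hQ : ∀ F, Q F → ∀ i, stem m h ∉ F i) :
    {S : Set (ExtVertex m (h + 1)) |
      stem m (h + 1) ∉ S ∧ (root m (h + 1) ∈ S ↔ p) ∧ Q (restr S)}.ncard = {F | Q F}.ncard := by
  refine Set.ncard_congr (fun S _ => restr S) (fun S hS => hS.2.2) ?_ ?_
  · rintro S S' ⟨hs, hr, -⟩ ⟨hs', hr', -⟩ hSS'
    rw [← glue_restr hs, ← glue_restr hs']
    have : S ∩ {root m (h + 1)} = S' ∩ {root m (h + 1)} := by
      ext x
      constructor
      · rintro ⟨hx, rfl⟩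
        exact ⟨hr'.2 (hr.1 hx), rfl⟩
      · rintro ⟨hx, rfl⟩
        exact ⟨hr.2 (hr'.1 hx), rfl⟩
    rw [this]
    exact congrArg _ hSS'
  · intro F hF
    have hrestr : restr (glue {x | x = root m (h + 1) ∧ p} F) = F := by
      funext i
      ext x
      constructor
      · rintro ⟨hx, H⟩
        rcases (emb_mem_glue hx).1 H with H | H
        · exact absurd (emb_eq_root.1 H.1) hx
        · exact H
      · intro hx
        have hxs : x ≠ stem m h := fun H => hQ F hF i (H ▸ hx)
        exact ⟨hxs, (emb_mem_glue hxs).2 (Or.inr hx)⟩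
    refine ⟨glue {x | x = root m (h + 1) ∧ p} F, ⟨?_, ?_, ?_⟩, hrestr⟩
    · rw [stem_mem_glue]
      exact fun H => root_ne_stem H.1.symm
    · rw [root_mem_glue]
      exact ⟨fun H => H.elim (fun H => H.2) fun ⟨i, H⟩ => absurd H (hQ F hF i),
        fun H => Or.inl ⟨rfl, H⟩⟩
    · rw [hrestr]
      exact hF

lemma stem_notMem_of_isTypeI_or_isTypeII {F : Fin m → Set (ExtVertex m h)}
    (H : ∀ i, IsTypeI m h (F i) ∨ IsTypeII m h (F i)) (i : Fin m) : stem m h ∉ F i :=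
  (H i).elim (fun H => H.1) fun H => H.1

lemma ncard_eq_iff_of_root_notMem {S : Set (ExtVertex m (h + 1))} (hs : stem m (h + 1) ∉ S)
    (hr : root m (h + 1) ∉ S) (k : ℤ) :
    (S.ncard : ℤ) = k ↔ ∑ i, ((restr S i).ncard : ℤ) = k := by
  rw [ncard_eq_add_sum_restr hs, Set.inter_singleton_eq_empty.2 hr, Set.ncard_empty, zero_add]
  push_cast
  rfl

lemma ncard_eq_iff_of_root_mem {S : Set (ExtVertex m (h + 1))} (hs : stem m (h + 1) ∉ S)
    (hr : root m (h + 1) ∈ S) (k : ℤ) :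
    (S.ncard : ℤ) = k ↔ ∑ i, ((restr S i).ncard : ℤ) = k - 1 := by
  rw [ncard_eq_add_sum_restr hs, Set.inter_singleton_of_mem hr, Set.ncard_singleton]
  push_cast
  omega

/-- If, for sets containing neither stem nor root, being of Type II is decided by the number of
parts of Type II, the Type II sets are counted by families. -/
lemma numH_succ (l : ℕ)
    (H : ∀ S : Set (ExtVertex m (h + 1)), stem m (h + 1) ∉ S → root m (h + 1) ∉ S →
      (IsTypeII m (h + 1) S ↔ (∀ i, IsTypeI m h (restr S i) ∨ IsTypeII m h (restr S i)) ∧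
        {i | IsTypeII m h (restr S i)}.ncard = l)) (k : ℤ) :
    numH m (h + 1) k = (families m h l k).ncard := by
  rw [numH, families,
    ← ncard_restr_preimage False _ fun F hF => stem_notMem_of_isTypeI_or_isTypeII hF.1]
  congr 1
  ext S
  simp only [Set.mem_ofPred_eq, iff_false]
  constructor
  · rintro ⟨hS, hk⟩
    have hr : root m (h + 1) ∉ S := fun hr => not_isTypeII_of_root_mem hr hS
    obtain ⟨h1, h2⟩ := (H S hS.1 hr).1 hS
    exact ⟨hS.1, hr, h1, h2, (ncard_eq_iff_of_root_notMem hS.1 hr k).1 hk⟩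
  · rintro ⟨hs, hr, h1, h2, h3⟩
    exact ⟨(H S hs hr).2 ⟨h1, h2⟩, (ncard_eq_iff_of_root_notMem hs hr k).2 h3⟩

/-- The Type I sets not containing the root have fewer than `N` parts of Type II; the parts of
those containing the root are of Type I or II without further restriction. -/
lemma numE_succ (N : ℕ)
    (H : ∀ S : Set (ExtVertex m (h + 1)), stem m (h + 1) ∉ S → root m (h + 1) ∉ S →
      (IsTypeI m (h + 1) S ↔ (∀ i, IsTypeI m h (restr S i) ∨ IsTypeII m h (restr S i)) ∧
        {i | IsTypeII m h (restr S i)}.ncard < N)) (k : ℤ) :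
    numE m (h + 1) k = ∑ l ∈ Finset.range N, (families m h l k).ncard +
      ∑ l ∈ Finset.range (m + 1), (families m h l (k - 1)).ncard := by
  have hcard : ∀ F : Fin m → Set (ExtVertex m h), {i | IsTypeII m h (F i)}.ncard < m + 1 := by
    intro F
    have := Set.ncard_le_card {i | IsTypeII m h (F i)}
    rw [Nat.card_eq_fintype_card, Fintype.card_fin] at this
    omega
  rw [← ncard_families_lt, ← ncard_families_lt,
    ← ncard_restr_preimage False _ fun F hF => stem_notMem_of_isTypeI_or_isTypeII hF.1,
    ← ncard_restr_preimage True _ fun F hF => stem_notMem_of_isTypeI_or_isTypeII hF.1,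
    ← Set.ncard_union_eq _ (Set.toFinite _) (Set.toFinite _), numE]
  · congr 1
    ext S
    simp only [Set.mem_ofPred_eq, Set.mem_union, iff_false, iff_true]
    constructor
    · rintro ⟨hS, hk⟩
      by_cases hr : root m (h + 1) ∈ S
      · exact Or.inr ⟨hS.1, hr, (isTypeI_iff_of_root_mem hS.1 hr).1 hS, hcard _,
          (ncard_eq_iff_of_root_mem hS.1 hr k).1 hk⟩
      · obtain ⟨h1, h2⟩ := (H S hS.1 hr).1 hS
        exact Or.inl ⟨hS.1, hr, h1, h2, (ncard_eq_iff_of_root_notMem hS.1 hr k).1 hk⟩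
    · rintro (⟨hs, hr, h1, h2, h3⟩ | ⟨hs, hr, h1, -, h3⟩)
      · exact ⟨(H S hs hr).2 ⟨h1, h2⟩, (ncard_eq_iff_of_root_notMem hs hr k).2 h3⟩
      · exact ⟨(isTypeI_iff_of_root_mem hs hr).2 h1, (ncard_eq_iff_of_root_mem hs hr k).2 h3⟩
  · exact Set.disjoint_left.2 fun S h1 h2 => h1.2.1.1 (h2.2.1.2 trivial)

lemma isTypeI_succ_iff_ncard_of_even (hm : 2 ≤ m) (hh : Even h)
    {S : Set (ExtVertex m (h + 1))} (hs : stem m (h + 1) ∉ S) (hr : root m (h + 1) ∉ S) :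
    IsTypeI m (h + 1) S ↔ (∀ i, IsTypeI m h (restr S i) ∨ IsTypeII m h (restr S i)) ∧
      {i | IsTypeII m h (restr S i)}.ncard < 1 := by
  rw [isTypeI_succ_iff_forall hm (fun X hX hX' => Nat.not_odd_iff_even.2 hh
    ((hX.root_mem_obs_iff hm).1 hX')) hs hr, Nat.lt_one_iff, Set.ncard_eq_zero (Set.toFinite _)]
  constructor
  · exact fun H => ⟨fun i => Or.inl (H i),
      Set.eq_empty_of_forall_notMem fun i hi => (H i).not_isTypeII hi⟩
  · rintro ⟨h1, h2⟩ i
    exact (h1 i).resolve_right fun hi => Set.eq_empty_iff_forall_notMem.1 h2 i hi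

lemma isTypeII_succ_iff_ncard_of_even (hm : 2 ≤ m) (hh : Even h)
    {S : Set (ExtVertex m (h + 1))} (hs : stem m (h + 1) ∉ S) (hr : root m (h + 1) ∉ S) :
    IsTypeII m (h + 1) S ↔ (∀ i, IsTypeI m h (restr S i) ∨ IsTypeII m h (restr S i)) ∧
      {i | IsTypeII m h (restr S i)}.ncard = 1 := by
  rw [isTypeII_succ_iff_exists_unique hm (fun X hX hX' => Nat.not_odd_iff_even.2 hh
    ((hX.root_mem_obs_iff hm).1 hX')) hs hr, Set.ncard_eq_one]
  constructor
  · rintro ⟨i₀, h₀, H⟩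
    refine ⟨fun i => ?_, i₀, ?_⟩
    · by_cases hi : i = i₀
      · exact Or.inr (hi ▸ h₀)
      · exact Or.inl (H i hi)
    · ext i
      refine ⟨fun hi => ?_, fun hi => hi ▸ h₀⟩
      by_contra hne
      exact (H i hne).not_isTypeII hi
  · rintro ⟨h1, i₀, h2⟩
    have hmem : ∀ i, IsTypeII m h (restr S i) ↔ i = i₀ := fun i => Set.ext_iff.1 h2 i
    exact ⟨i₀, (hmem i₀).2 rfl, fun i hi => (h1 i).resolve_right fun h => hi ((hmem i).1 h)⟩

lemma ncard_eq_iff_forall (P : Fin m → Prop) : {i | P i}.ncard = m ↔ ∀ i, P i := by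
  constructor
  · intro H i
    have : {i | P i} = Set.univ :=
      Set.eq_of_subset_of_ncard_le (Set.subset_univ _) (by simp [H, Set.ncard_univ])
    exact Set.eq_univ_iff_forall.1 this i
  · intro H
    rw [show {i | P i} = Set.univ from Set.eq_univ_of_forall H]
    simp [Set.ncard_univ]

lemma isTypeI_succ_iff_ncard_of_odd (hm : 2 ≤ m) (hh : Odd h)
    {S : Set (ExtVertex m (h + 1))} (hs : stem m (h + 1) ∉ S) (hr : root m (h + 1) ∉ S) :
    IsTypeI m (h + 1) S ↔ (∀ i, IsTypeI m h (restr S i) ∨ IsTypeII m h (restr S i)) ∧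
      {i | IsTypeII m h (restr S i)}.ncard < m := by
  rw [isTypeI_succ_iff_exists (fun X hX => (hX.root_mem_obs_iff hm).2 hh) hs hr]
  refine and_congr_right fun h1 => ?_
  have hle : {i | IsTypeII m h (restr S i)}.ncard ≤ m := by
    simpa using Set.ncard_le_card {i | IsTypeII m h (restr S i)}
  rw [lt_iff_le_and_ne, and_iff_right hle, Ne, ncard_eq_iff_forall, not_forall]
  exact exists_congr fun i => ⟨fun H => H.not_isTypeII, (h1 i).resolve_right⟩

lemma isTypeII_succ_iff_ncard_of_odd (hm : 2 ≤ m) (hh : Odd h)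
    {S : Set (ExtVertex m (h + 1))} (hs : stem m (h + 1) ∉ S) (hr : root m (h + 1) ∉ S) :
    IsTypeII m (h + 1) S ↔ (∀ i, IsTypeI m h (restr S i) ∨ IsTypeII m h (restr S i)) ∧
      {i | IsTypeII m h (restr S i)}.ncard = m := by
  rw [isTypeII_succ_iff_forall (fun X hX => (hX.root_mem_obs_iff hm).2 hh) hs hr,
    ncard_eq_iff_forall]
  exact ⟨fun H => ⟨fun i => Or.inr (H i), H⟩, fun H => H.2⟩

end Counting

end PowerDom

theorem mainTheorem2 (m h : ℕ) (hm : 2 ≤ m) (hh : 1 ≤ h) :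
    (∀ S : Set (ExtVertex m h), IsTypeII m h S →
      (Odd h → ∃ i : Fin m,
        closedNbhd (extTree m h) {root m h} \ obs (extTree m h) S =
          {stem m h, rootChild m h hh i}) ∧
      (Even h →
        closedNbhd (extTree m h) {root m h} \ obs (extTree m h) S =
          {stem m h, root m h})) ∧
    (∀ k : ℤ,
      (Odd h → numH m h k = bracket m (h - 1) 1 k) ∧
      (Even h → numH m h k = bracket m (h - 1) m k)) ∧
    (∀ k : ℤ,
      (Odd h → numE m h k =
        bracket m (h - 1) 0 k + ∑ l ∈ Finset.range (m + 1), bracket m (h - 1) l (k - 1)) ∧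
      (Even h → numE m h k =
        ∑ l ∈ Finset.range m, bracket m (h - 1) l k +
          ∑ l ∈ Finset.range (m + 1), bracket m (h - 1) l (k - 1))) := by
  obtain ⟨n, rfl⟩ : ∃ n, h = n + 1 := ⟨h - 1, by omega⟩
  have hodd : Odd (n + 1) → Even n := fun H => Nat.not_odd_iff_even.1 (Nat.odd_add_one.1 H)
  have heven : Even (n + 1) → Odd n := fun H => Nat.not_even_iff_odd.1 (Nat.even_add_one.1 H)
  have hsum : ∀ N ≤ m + 1, ∀ k, ∑ l ∈ Finset.range N, (families m n l k).ncard =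
      ∑ l ∈ Finset.range N, bracket m n l k := fun N hN k =>
    Finset.sum_congr rfl fun l hl => ncard_families l (by have := Finset.mem_range.1 hl; omega) k
  rw [Nat.add_sub_cancel]
  refine ⟨fun S hS => ⟨fun hp => hS.closedNbhd_diff_obs_of_even hm (hodd hp),
    fun hp => hS.closedNbhd_diff_obs_of_odd hm (heven hp)⟩,
    fun k => ⟨fun hp => ?_, fun hp => ?_⟩, fun k => ⟨fun hp => ?_, fun hp => ?_⟩⟩
  · rw [numH_succ 1 (fun S hs hr => isTypeII_succ_iff_ncard_of_even hm (hodd hp) hs hr),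
      ncard_families 1 (by omega)]
  · rw [numH_succ m (fun S hs hr => isTypeII_succ_iff_ncard_of_odd hm (heven hp) hs hr),
      ncard_families m le_rfl]
  · rw [numE_succ 1 (fun S hs hr => isTypeI_succ_iff_ncard_of_even hm (hodd hp) hs hr),
      hsum 1 (by omega), hsum (m + 1) le_rfl, Finset.sum_range_one]
  · rw [numE_succ m (fun S hs hr => isTypeI_succ_iff_ncard_of_odd hm (heven hp) hs hr),
      hsum m (by omega), hsum (m + 1) le_rfl]
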